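/- Let $S$ be a commutative $\omega$-continuous semiring: it is partially ordered by its natural order $a\le b\Leftrightarrow\exists d\; a+d=b$, suprema of $\omega$-chains exist, and $+$ and $\cdot$ preserve them in each argument. Countable sums in $S$ are the suprema of their finite partial sums. Let $k\ge 1$ be an integer such that $k=k+1$ holds in $S$ ($k$ denoting $1+\dots+1$, $k$ times). Let $G$ be a context-free grammar with finite alphabet $A$, a finite set $\mathcal X$ of $n$ variables and finitely many rules, and let $h\colon A\to S$ be a valuation. Consider the algebraic system $X=f_X$ $(X\in\mathcal X)$ associated with $G$, where $f_X=\sum_{X\to\gamma}\gamma$ is read over $S$ with each letter $a$ interpreted as $h(a)$. For a variable $X$ of a grammar, let $\mathrm{camb}_X\colon\mathbb N^A\to\mathbb N\cup\{\infty\}$ map a vector $v$ to the number of derivation trees with root variable $X$ whose yield has Parikh vector $v$. For $s\colon\mathbb N^A\to\mathbb N\cup\{\infty\}$ put $h(s)=\sum_{v\in\mathbb N^A}s(v)\prod_{a\in A}h(a)^{v(a)}$, where $\infty$ is read as $\sum_{i\in\mathbb N}1$ in $S$. For $d\in\mathbb N$ let $G^{\le d}$ be the grammar over $A$ with variables $X^{\le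 e},X^{=e}$ ($X\in\mathcal X$, $0\le e\le d$) and exactly the following rules: - $X^{\le e}\to X^{=e'}$ for all $X\in\mathcal X$ and $0\le e'\le e\le d$; - $X^{=0}\to u_0$ for each rule $X\to u_0$ of $G$ without variables on the right-hand side; - $X^{=e}\to u_0X_1^{=e}u_1$ for each rule $X\to u_0X_1u_1$ of $G$ with exactly one variable occurrence and all $0\le e\le d$; - for each rule $X\to u_0X_1u_1\cdots X_ru_r$ of $G$ with $r\ge2$ variable occurrences and all $1\le e\le d$, the rules $X^{=e}\to u_0Z_1u_1\cdots Z_ru_r$ where either, for some $j$, $Z_j=X_j^{=e}$ and $Z_i=X_i^{\le e-1}$ for all $i\ne j$; or, for some $J\subseteq\{1,\dots,r\}$ with $|J|\ge 2$, $Z_i=X_i^{=e-1}$ for $i\in J$ and $Z_i=X_i^{\le e-2}$ for $i\notin J$ (the latter only if $e\ge2$ or $J=\{1,\dots,r\}$, so that all $Z_i$ are defined). Put $d=n+\lceil\log_2\log_2 k\rceil$ if $k\ge 2$, and $d=n$ if $k=1$. Then: 1. The least solution of the system over $S$ is $\bigl(h(\mathrm{camb}_{X^{\le d}})\bigr)_{X\in\mathcal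 X}$, where $\mathrm{camb}_{X^{\le d}}$ is taken in $G^{\le d}$. 2. Newton's method reaches the least solution after at most $d$ steps. That is, call $(\nu^{(i)})_{i\in\mathbb N}$ a Newton sequence if $\nu^{(0)}=f(0)$ and, for every $i$, $\nu^{(i+1)}=\nu^{(i)}+\Delta$, where $\Delta$ is the least solution of $y=Df|_{\nu^{(i)}}(y)+\delta$ for some $\delta$ with $f(\nu^{(i)})=\nu^{(i)}+\delta$ (here $Df|_u$ is the formal differential of the polynomial map $f$ at $u$). Then Newton sequences exist, and every Newton sequence satisfies that $\nu^{(i)}$ is the least solution for all $i\ge d$. -/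

import Mathlib

namespace CamNewton

/-! ### Commutative ω-continuous semirings -/

/-- An ω-continuous semiring. `CanonicallyOrderedAdd` says that `≤` is the natural order
`a ≤ b ↔ ∃ d, b = a + d`. Suprema of ω-chains exist, and addition and multiplication preserve
them in each argument. -/
class OmegaContinuous (S : Type*) [Semiring S] [PartialOrder S] [CanonicallyOrderedAdd S] :
    Prop where
  exists_isLUB : ∀ a : ℕ → S, Monotone a → ∃ s, IsLUB (Set.range a) s
  add_isLUB : ∀ (a : ℕ → S) (s b : S), Monotone a → IsLUB (Set.range a) s →
    IsLUB (Set.range fun i => b + a i) (b + s)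
  mul_left_isLUB : ∀ (a : ℕ → S) (s b : S), Monotone a → IsLUB (Set.range a) s →
    IsLUB (Set.range fun i => b * a i) (b * s)
  mul_right_isLUB : ∀ (a : ℕ → S) (s b : S), Monotone a → IsLUB (Set.range a) s →
    IsLUB (Set.range fun i => a i * b) (s * b)

section Sums

variable {S : Type*} [Semiring S] [PartialOrder S] [CanonicallyOrderedAdd S]

theorem exists_isLUB_sums [OmegaContinuous S] {ι : Type*} [Countable ι] (a : ι → S) :
    ∃ s, IsLUB (Set.range fun F : Finset ι => ∑ i ∈ F, a i) s := by
  classical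
  obtain ⟨e, he⟩ := exists_injective_nat ι
  have hfin : ∀ n : ℕ, {i : ι | e i < n}.Finite := fun n =>
    (Set.finite_lt_nat n).preimage he.injOn
  have key : ∀ F G : Finset ι, F ⊆ G → ∑ i ∈ F, a i ≤ ∑ i ∈ G, a i := by
    intro F G h
    rw [← Finset.sum_sdiff h]
    exact le_add_self
  have hmono : Monotone fun n => ∑ i ∈ (hfin n).toFinset, a i := by
    intro m n hmn
    refine key _ _ fun i hi => ?_
    simp only [Set.Finite.mem_toFinset, Set.mem_ofPred_eq] at hi ⊢
    omega
  obtain ⟨s, hs⟩ := OmegaContinuous.exists_isLUB _ hmono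
  refine ⟨s, ?_, ?_⟩
  · rintro _ ⟨F, rfl⟩
    refine le_trans (key F (hfin (F.sup e + 1)).toFinset fun i hi => ?_) (hs.1 ⟨F.sup e + 1, rfl⟩)
    simp only [Set.Finite.mem_toFinset, Set.mem_ofPred_eq]
    exact Nat.lt_succ_of_le (Finset.le_sup hi)
  · intro b hb
    refine hs.2 ?_
    rintro _ ⟨n, rfl⟩
    exact hb ⟨_, rfl⟩

open Classical in
/-- The countable sum `∑ i, a i`: the supremum of the finite partial sums. -/
noncomputable def osum {ι : Type*} (a : ι → S) : S :=
  if h : ∃ s, IsLUB (Set.range fun F : Finset ι => ∑ i ∈ F, a i) s then h.choose else 0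

/-- In an ω-continuous semiring every countable sum is the supremum of its partial sums, so the
default value in `osum` is never used. -/
theorem isLUB_osum [OmegaContinuous S] {ι : Type*} [Countable ι] (a : ι → S) :
    IsLUB (Set.range fun F : Finset ι => ∑ i ∈ F, a i) (osum a) := by
  have h := exists_isLUB_sums a
  rw [osum, dif_pos h]
  exact h.choose_spec

/-- The Kleene star `a* = ∑ i, a ^ i`. -/
noncomputable def kstar (a : S) : S := osum fun i : ℕ => a ^ i

/-- The canonical map from the extended natural numbers to `S`, with `∞ ↦ 1*`. -/
noncomputable def ofENat : ℕ∞ → S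
  | ⊤ => kstar 1
  | (n : ℕ) => (n : S)

end Sums

/-! ### Context-free grammars, derivation trees and commutative ambiguity -/

/-- A context-free grammar with alphabet `A`, variables `V` and no distinguished start symbol. -/
structure Grammar (A V : Type*) where
  rules : Finset (ContextFreeRule A V)

/-- The derivation trees of `G` with root variable `X`. The root is labelled by a rule `X → γ`,
and there is one child, a derivation tree with root variable `Y`, for each position of `γ` that
holds a variable `Y`. -/
inductive DTree {A V : Type*} (G : Grammar A V) : V → Type _ where
  | node {X : V} (r : ContextFreeRule A V) (hr : r ∈ G.rules) (hX : r.input = X)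
      (child : ∀ (i : Fin r.output.length) (Y : V),
        r.output[i] = Symbol.nonterminal Y → DTree G Y) : DTree G X

/-- The yield of a derivation tree: the word over `A` that is read off its leaves. -/
def DTree.yield {A V : Type*} {G : Grammar A V} {X : V} : DTree G X → List A
  | .node r _ _ child => (List.ofFn fun i : Fin r.output.length =>
      match h : r.output[i] with
      | .terminal a => [a]
      | .nonterminal Y => (child i Y h).yield).flatten

/-- The Parikh vector of a word. -/
def parikh {A : Type*} [DecidableEq A] (w : List A) : A → ℕ := fun a => w.count a

/-- The commutative ambiguity: the number (possibly `∞`) of derivation trees with root variable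
`X` whose yield has Parikh vector `v`. -/
noncomputable def camb {A V : Type*} [DecidableEq A] (G : Grammar A V) (X : V) (v : A → ℕ) : ℕ∞ :=
  {t : DTree G X | parikh t.yield = v}.encard

/-! ### The unfolded grammar -/

/-- Variables of the unfolded grammars: `atMost X d` is `X^{≤ d}` and `exactly X d` is `X^{= d}`. -/
inductive UVar (V : Type*) where
  | atMost (X : V) (d : ℕ) : UVar V
  | exactly (X : V) (d : ℕ) : UVar V
deriving DecidableEq

/-- Whether a symbol is a variable. -/
def isVar {A V : Type*} : Symbol A V → Bool
  | .terminal _ => false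
  | .nonterminal _ => true

/-- The positions of the word `γ` that hold a variable. -/
def varPos {A V : Type*} (γ : List (Symbol A V)) : Finset ℕ :=
  (Finset.range γ.length).filter fun i => γ[i]?.any isVar

/-- Replace every variable `Y` at a position `i` of `γ` by `z i Y`. -/
def relabel {A V W : Type*} (z : ℕ → V → W) (γ : List (Symbol A V)) : List (Symbol A W) :=
  γ.mapIdx fun i s =>
    match s with
    | .terminal a => .terminal a
    | .nonterminal Y => .nonterminal (z i Y)

open UVar in
/-- The rules of the unfolding that stem from the rule `X → γ`. -/
def unfoldRule {A V : Type*} [DecidableEq A] [DecidableEq V] (k : ℕ) (r : ContextFreeRule A V) :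
    Finset (ContextFreeRule A (UVar V)) :=
  if (varPos r.output).card = 0 then
    {⟨exactly r.input 0, relabel (fun _ Y => exactly Y 0) r.output⟩}
  else if (varPos r.output).card = 1 then
    (Finset.range (k + 1)).image fun d =>
      ⟨exactly r.input d, relabel (fun _ Y => exactly Y d) r.output⟩
  else
    (Finset.Icc 1 k).biUnion fun d =>
      ((varPos r.output).image fun j =>
        ⟨exactly r.input d,
          relabel (fun i Y => if i = j then exactly Y d else atMost Y (d - 1)) r.output⟩) ∪
      (((varPos r.output).powerset.filter fun J =>
          2 ≤ J.card ∧ (2 ≤ d ∨ J = varPos r.output)).image fun J =>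
        ⟨exactly r.input d,
          relabel (fun i Y => if i ∈ J then exactly Y (d - 1) else atMost Y (d - 2)) r.output⟩)

open UVar in
/-- The unfolding `G^{≤ k}`. Only variables `X^{≤ d}`, `X^{= d}` with `d ≤ k` occur in its rules. -/
def Grammar.unfold {A V : Type*} [DecidableEq A] [DecidableEq V] [Fintype V] (G : Grammar A V)
    (k : ℕ) : Grammar A (UVar V) where
  rules :=
    ((Finset.univ : Finset V).biUnion fun X => (Finset.range (k + 1)).biUnion fun d =>
      (Finset.range (d + 1)).image fun e =>
        ⟨atMost X d, [Symbol.nonterminal (exactly X e)]⟩) ∪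
    G.rules.biUnion (unfoldRule k)

/-! ### Algebraic systems, valuations and Newton's method -/

section Systems

variable {A V S : Type*} [CommSemiring S]

/-- The value of a monomial, i.e. of a word over letters and variables. -/
def monoVal (h : A → S) (x : V → S) : List (Symbol A V) → S
  | [] => 1
  | .terminal a :: γ => h a * monoVal h x γ
  | .nonterminal Y :: γ => x Y * monoVal h x γ

/-- The differential of a monomial at the point `u` in direction `x`, by the product rule. -/
def monoDiff (h : A → S) (u x : V → S) : List (Symbol A V) → S
  | [] => 0
  | .terminal a :: γ => h a * monoDiff h u x γ
  | .nonterminal Y :: γ => x Y * monoVal h u γ + u Y * monoDiff h u x γ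

/-- The right-hand sides `X ↦ ∑_{X → γ} γ` of the algebraic system of `G` under the valuation
`h`, evaluated at `x`. -/
def Grammar.system [DecidableEq V] (G : Grammar A V) (h : A → S) (x : V → S) : V → S :=
  fun X => ∑ r ∈ G.rules with r.input = X, monoVal h x r.output

/-- The differential at `u` of the right-hand sides, in direction `x`. -/
def Grammar.diff [DecidableEq V] (G : Grammar A V) (h : A → S) (u x : V → S) : V → S :=
  fun X => ∑ r ∈ G.rules with r.input = X, monoDiff h u x r.output

variable [PartialOrder S]

/-- `x` is the least solution of the algebraic system of `G` under `h`. -/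
def Grammar.IsLeastSolution [DecidableEq V] (G : Grammar A V) (h : A → S) (x : V → S) : Prop :=
  IsLeast {y : V → S | y = G.system h y} x

/-- `ν` is a sequence of Newton approximants of the system `x = f x`: it starts at `f 0`, and
`ν (i + 1) = ν i + Δ` where `Δ` is the least solution of the linear system
`y = Df|_{ν i} (y) + δ` for some `δ` with `f (ν i) = ν i + δ`. -/
def Grammar.IsNewtonSequence [DecidableEq V] (G : Grammar A V) (h : A → S) (ν : ℕ → V → S) :
    Prop :=
  ν 0 = G.system h 0 ∧
  ∀ i, ∃ δ Δ : V → S, G.system h (ν i) = ν i + δ ∧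
    IsLeast {y : V → S | y = G.diff h (ν i) y + δ} Δ ∧ ν (i + 1) = ν i + Δ

/-- The ω-continuous homomorphism induced by the valuation `h`, on a power series with
coefficients in `ℕ∞` and commuting variables: `s ↦ ∑ v, s v * ∏ a, h a ^ v a`. -/
noncomputable def evalSeries [CanonicallyOrderedAdd S] [Fintype A] (h : A → S)
    (s : (A → ℕ) → ℕ∞) : S :=
  osum fun v : A → ℕ => ofENat (s v) * ∏ a, h a ^ v a

end Systems

/-! ### The iterated logarithm -/

/-- `⌈log₂ log₂ k⌉` for `k ≥ 2`, and `0` for `k = 1`. -/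
def logLog (k : ℕ) : ℕ := Nat.clog 2 (Nat.clog 2 k)

/-- `logLog k` is the least natural number `m` with `k ≤ 2 ^ 2 ^ m`. -/
theorem logLog_le_iff (k m : ℕ) : logLog k ≤ m ↔ k ≤ 2 ^ 2 ^ m := by
  rw [logLog, Nat.clog_le_iff_le_pow one_lt_two, Nat.clog_le_iff_le_pow one_lt_two]

end CamNewton

open CamNewton

namespace CamNewton

set_option linter.unusedSectionVars false

attribute [local instance] CanonicallyOrderedAdd.toIsOrderedRing

/-! ### Continuous maps and Kleene's fixed point theorem -/

section Kleene

variable {V S : Type*} [CommSemiring S] [PartialOrder S]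

/-- Monotone maps that preserve suprema of ω-chains. -/
def OmegaCont (F : (V → S) → S) : Prop :=
  Monotone F ∧ ∀ (a : ℕ → V → S) (s : V → S), Monotone a → IsLUB (Set.range a) s →
    IsLUB (Set.range fun i => F (a i)) (F s)

theorem isLUB_range_apply {a : ℕ → V → S} {s : V → S} (h : IsLUB (Set.range a) s) (X : V) :
    IsLUB (Set.range fun i => a i X) (s X) := by
  have := isLUB_pi.1 h X
  rwa [← Set.range_comp] at this

theorem isLUB_range_of_apply {a : ℕ → V → S} {s : V → S}
    (h : ∀ X, IsLUB (Set.range fun i => a i X) (s X)) : IsLUB (Set.range a) s := by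
  refine isLUB_pi.2 fun X => ?_
  rw [← Set.range_comp]
  exact h X

theorem omegaCont_const (c : S) : OmegaCont fun _ : V → S => c := by
  refine ⟨fun _ _ _ => le_rfl, fun a s _ _ => ⟨?_, fun b hb => hb ⟨0, rfl⟩⟩⟩
  rintro _ ⟨_, rfl⟩
  exact le_rfl

theorem omegaCont_apply (X : V) : OmegaCont fun x : V → S => x X :=
  ⟨fun _ _ h => h X, fun _ _ _ hs => isLUB_range_apply hs X⟩

variable [CanonicallyOrderedAdd S]

theorem OmegaCont.add [OmegaContinuous S] {F H : (V → S) → S} (hF : OmegaCont F)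
    (hH : OmegaCont H) : OmegaCont fun x => F x + H x := by
  refine ⟨fun _ _ h => add_le_add (hF.1 h) (hH.1 h), fun a s ha hs => ⟨?_, fun b hb => ?_⟩⟩
  · rintro _ ⟨i, rfl⟩
    exact add_le_add (hF.1 (hs.1 ⟨i, rfl⟩)) (hH.1 (hs.1 ⟨i, rfl⟩))
  · have h1 : ∀ i, F (a i) + H s ≤ b := by
      intro i
      refine (OmegaContinuous.add_isLUB (fun j => H (a j)) _ _ (fun _ _ h => hH.1 (ha h))
        (hH.2 a s ha hs)).2 ?_
      rintro _ ⟨j, rfl⟩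
      exact (add_le_add (hF.1 (ha (le_max_left i j))) (hH.1 (ha (le_max_right i j)))).trans
        (hb ⟨max i j, rfl⟩)
    show F s + H s ≤ b
    rw [add_comm]
    refine (OmegaContinuous.add_isLUB (fun j => F (a j)) _ _ (fun _ _ h => hF.1 (ha h))
        (hF.2 a s ha hs)).2 ?_
    rintro _ ⟨i, rfl⟩
    exact (add_comm _ _).trans_le (h1 i)

theorem OmegaCont.mul [OmegaContinuous S] {F H : (V → S) → S} (hF : OmegaCont F)
    (hH : OmegaCont H) : OmegaCont fun x => F x * H x := by
  refine ⟨fun _ _ h => mul_le_mul' (hF.1 h) (hH.1 h), fun a s ha hs => ⟨?_, fun b hb => ?_⟩⟩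
  · rintro _ ⟨i, rfl⟩
    exact mul_le_mul' (hF.1 (hs.1 ⟨i, rfl⟩)) (hH.1 (hs.1 ⟨i, rfl⟩))
  · have h1 : ∀ i, F (a i) * H s ≤ b := by
      intro i
      refine (OmegaContinuous.mul_left_isLUB (fun j => H (a j)) _ _ (fun _ _ h => hH.1 (ha h))
        (hH.2 a s ha hs)).2 ?_
      rintro _ ⟨j, rfl⟩
      exact (mul_le_mul' (hF.1 (ha (le_max_left i j))) (hH.1 (ha (le_max_right i j)))).trans
        (hb ⟨max i j, rfl⟩)
    refine (OmegaContinuous.mul_right_isLUB (fun j => F (a j)) _ _ (fun _ _ h => hF.1 (ha h))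
        (hF.2 a s ha hs)).2 ?_
    rintro _ ⟨i, rfl⟩
    exact h1 i

theorem omegaCont_sum [OmegaContinuous S] {ι : Type*} (s : Finset ι) {F : ι → (V → S) → S}
    (hF : ∀ i, OmegaCont (F i)) : OmegaCont fun x => ∑ i ∈ s, F i x := by
  classical
  induction s using Finset.induction_on with
  | empty => simpa using omegaCont_const 0
  | insert i s hi ih =>
    simp only [Finset.sum_insert hi]
    exact (hF i).add ih

theorem iterate_zero_monotone {F : (V → S) → V → S} (hF : Monotone F) :
    Monotone fun n => F^[n] 0 :=
  monotone_nat_of_le_succ fun n => by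
    induction n with
    | zero => exact fun _ => zero_le
    | succ n ih =>
      simp only [Function.iterate_succ_apply'] at ih ⊢
      exact hF ih

theorem exists_isLUB_iterate [OmegaContinuous S] {F : (V → S) → V → S} (hF : Monotone F) :
    ∃ x, IsLUB (Set.range fun n => F^[n] 0) x := by
  choose x hx using fun X => OmegaContinuous.exists_isLUB (fun n => F^[n] 0 X)
    (fun _ _ h => iterate_zero_monotone hF h X)
  exact ⟨x, isLUB_range_of_apply hx⟩

theorem isLUB_iterate_le {F : (V → S) → V → S} (hF : Monotone F) {x y : V → S}
    (hx : IsLUB (Set.range fun n => F^[n] 0) x) (hy : F y ≤ y) : x ≤ y := by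
  refine hx.2 ?_
  rintro _ ⟨n, rfl⟩
  induction n with
  | zero => exact fun _ => zero_le
  | succ n ih =>
    simp only [Function.iterate_succ_apply'] at ih ⊢
    exact (hF ih).trans hy

theorem isLeast_of_isLUB_iterate {F : (V → S) → V → S}
    (hF : ∀ X, OmegaCont fun x => F x X) {x : V → S}
    (hx : IsLUB (Set.range fun n => F^[n] 0) x) : IsLeast {y | y = F y} x := by
  have hmono : Monotone F := fun _ _ h X => (hF X).1 h
  refine ⟨?_, fun y hy => isLUB_iterate_le hmono hx (le_of_eq hy.symm)⟩
  have h1 : IsLUB (Set.range fun n => F (F^[n] 0)) (F x) :=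
    isLUB_range_of_apply fun X => (hF X).2 _ _ (iterate_zero_monotone hmono) hx
  refine hx.unique ⟨?_, fun b hb => h1.2 ?_⟩
  · rintro _ ⟨n, rfl⟩
    exact (iterate_zero_monotone hmono n.le_succ).trans
      (h1.1 ⟨n, (Function.iterate_succ_apply' F n 0).symm⟩)
  · rintro _ ⟨n, rfl⟩
    exact hb ⟨n + 1, Function.iterate_succ_apply' F n 0⟩

theorem exists_isLeast_fixedPoint [OmegaContinuous S] {F : (V → S) → V → S}
    (hF : ∀ X, OmegaCont fun x => F x X) : ∃ x, IsLeast {y | y = F y} x :=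
  let ⟨x, hx⟩ := exists_isLUB_iterate fun _ _ h X => (hF X).1 h
  ⟨x, isLeast_of_isLUB_iterate hF hx⟩

theorem IsLeast.isLUB_iterate [OmegaContinuous S] {F : (V → S) → V → S}
    (hF : ∀ X, OmegaCont fun x => F x X) {x : V → S} (hx : IsLeast {y | y = F y} x) :
    IsLUB (Set.range fun n => F^[n] 0) x := by
  obtain ⟨y, hy⟩ := exists_isLUB_iterate (F := F) fun _ _ h X => (hF X).1 h
  rwa [hx.unique (isLeast_of_isLUB_iterate hF hy)]

end Kleene

/-! ### Algebraic systems and Newton sequences -/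

section Newton

variable {A V S : Type*} [DecidableEq V] [CommSemiring S] [PartialOrder S]
  [CanonicallyOrderedAdd S] (G : Grammar A V) (h : A → S)

theorem monoVal_omegaCont [OmegaContinuous S] (γ : List (Symbol A V)) :
    OmegaCont fun x => monoVal h x γ := by
  induction γ with
  | nil => exact omegaCont_const 1
  | cons s γ ih =>
    cases s with
    | terminal a => exact (omegaCont_const _).mul ih
    | nonterminal Y => exact (omegaCont_apply Y).mul ih

theorem monoDiff_omegaCont [OmegaContinuous S] (u : V → S) (γ : List (Symbol A V)) :
    OmegaCont fun x => monoDiff h u x γ := by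
  induction γ with
  | nil => exact omegaCont_const 0
  | cons s γ ih =>
    cases s with
    | terminal a => exact (omegaCont_const _).mul ih
    | nonterminal Y =>
      exact ((omegaCont_apply Y).mul (omegaCont_const _)).add ((omegaCont_const _).mul ih)

theorem Grammar.system_omegaCont [OmegaContinuous S] (X : V) :
    OmegaCont fun x => G.system h x X :=
  omegaCont_sum _ fun r : ContextFreeRule A V => monoVal_omegaCont h r.output

theorem Grammar.diff_omegaCont [OmegaContinuous S] (u δ : V → S) (X : V) :
    OmegaCont fun x => (G.diff h u x + δ) X :=
  (omegaCont_sum _ fun r : ContextFreeRule A V => monoDiff_omegaCont h u r.output).add (omegaCont_const _)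

theorem Grammar.system_mono [OmegaContinuous S] : Monotone (G.system h) :=
  fun _ _ hxy X => (G.system_omegaCont h X).1 hxy

theorem monoVal_mono {u u' : V → S} (hu : u ≤ u') (γ : List (Symbol A V)) :
    monoVal h u γ ≤ monoVal h u' γ := by
  induction γ with
  | nil => exact le_rfl
  | cons s γ ih =>
    cases s with
    | terminal a => exact mul_le_mul' le_rfl ih
    | nonterminal Y => exact mul_le_mul' (hu Y) ih

theorem monoVal_add_monoDiff_le (u x : V → S) (γ : List (Symbol A V)) :
    monoVal h u γ + monoDiff h u x γ ≤ monoVal h (u + x) γ := by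
  induction γ with
  | nil => simp [monoVal, monoDiff]
  | cons s γ ih =>
    cases s with
    | terminal a =>
      simp only [monoVal, monoDiff, ← mul_add]
      exact mul_le_mul' le_rfl ih
    | nonterminal Y =>
      simp only [monoVal, monoDiff, Pi.add_apply, add_mul]
      calc u Y * monoVal h u γ + (x Y * monoVal h u γ + u Y * monoDiff h u x γ)
          = u Y * (monoVal h u γ + monoDiff h u x γ) + x Y * monoVal h u γ := by ring
        _ ≤ _ := add_le_add (mul_le_mul' le_rfl ih) (mul_le_mul' le_rfl
            (monoVal_mono h (fun Z => le_self_add) γ))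

/-- The first-order part of a monomial at `u + x` is monotone in `u` and `u + x`. -/
theorem monoVal_add_monoDiff_mono {u x u' x' : V → S} (hu : u ≤ u') (hx : u + x ≤ u' + x')
    (γ : List (Symbol A V)) :
    monoVal h u γ + monoDiff h u x γ ≤ monoVal h u' γ + monoDiff h u' x' γ := by
  induction γ with
  | nil => exact le_rfl
  | cons s γ ih =>
    cases s with
    | terminal a =>
      simp only [monoVal, monoDiff, ← mul_add]
      exact mul_le_mul' le_rfl ih
    | nonterminal Y =>
      simp only [monoVal, monoDiff]
      calc u Y * monoVal h u γ + (x Y * monoVal h u γ + u Y * monoDiff h u x γ)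
          = (u Y + x Y) * monoVal h u γ + u Y * monoDiff h u x γ := by ring
        _ ≤ (u' Y + x' Y) * monoVal h u γ + u' Y * monoDiff h u x γ :=
            add_le_add (mul_le_mul' (hx Y) le_rfl) (mul_le_mul' (hu Y) le_rfl)
        _ = u' Y * (monoVal h u γ + monoDiff h u x γ) + x' Y * monoVal h u γ := by ring
        _ ≤ u' Y * (monoVal h u' γ + monoDiff h u' x' γ) + x' Y * monoVal h u' γ :=
            add_le_add (mul_le_mul' le_rfl ih) (mul_le_mul' le_rfl (monoVal_mono h hu γ))
        _ = _ := by ring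

theorem Grammar.system_add_diff_le (u x : V → S) :
    G.system h u + G.diff h u x ≤ G.system h (u + x) := fun X => by
  simp only [Grammar.system, Grammar.diff, Pi.add_apply, ← Finset.sum_add_distrib]
  exact Finset.sum_le_sum fun r _ => monoVal_add_monoDiff_le h u x r.output

theorem Grammar.system_add_diff_mono {u x u' x' : V → S} (hu : u ≤ u') (hx : u + x ≤ u' + x') :
    G.system h u + G.diff h u x ≤ G.system h u' + G.diff h u' x' := fun X => by
  simp only [Grammar.system, Grammar.diff, Pi.add_apply, ← Finset.sum_add_distrib]
  exact Finset.sum_le_sum fun r _ => monoVal_add_monoDiff_mono h hu hx r.output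

variable {G h}

theorem newton_step_eq {ν δ Δ : V → S} (hδ : G.system h ν = ν + δ)
    (hΔ : IsLeast {y : V → S | y = G.diff h ν y + δ} Δ) :
    ν + Δ = G.system h ν + G.diff h ν Δ := by
  have h1 : Δ = G.diff h ν Δ + δ := hΔ.1
  calc ν + Δ = ν + (G.diff h ν Δ + δ) := by rw [← h1]
    _ = ν + δ + G.diff h ν Δ := by rw [add_comm (G.diff h ν Δ), add_assoc]
    _ = _ := by rw [hδ]

variable (G h)

theorem Grammar.exists_isNewtonSequence [OmegaContinuous S] :
    ∃ ν : ℕ → V → S, G.IsNewtonSequence h ν := by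
  have step : ∀ ν : {ν : V → S // ν ≤ G.system h ν}, ∃ ν' : {ν : V → S // ν ≤ G.system h ν},
      ∃ δ Δ : V → S, G.system h ν.1 = ν.1 + δ ∧
        IsLeast {y : V → S | y = G.diff h ν.1 y + δ} Δ ∧ ν'.1 = ν.1 + Δ := by
    rintro ⟨ν, hν⟩
    choose δ hδ using fun X => exists_add_of_le (hν X)
    have hδ' : G.system h ν = ν + δ := funext hδ
    obtain ⟨Δ, hΔ⟩ := exists_isLeast_fixedPoint (G.diff_omegaCont h ν δ)
    refine ⟨⟨ν + Δ, ?_⟩, δ, Δ, hδ', hΔ, rfl⟩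
    exact (newton_step_eq hδ' hΔ).trans_le (G.system_add_diff_le h ν Δ)
  choose next hnext using step
  let ν₀ : {ν : V → S // ν ≤ G.system h ν} :=
    ⟨G.system h 0, G.system_mono h fun _ => zero_le⟩
  refine ⟨fun n => (next^[n] ν₀).1, rfl, fun i => ?_⟩
  simp only [Function.iterate_succ_apply']
  exact hnext _

variable {G h}

theorem Grammar.IsNewtonSequence.le_leastSolution [OmegaContinuous S] {ν : ℕ → V → S}
    (hν : G.IsNewtonSequence h ν) {μ : V → S} (hμ : G.IsLeastSolution h μ) (i : ℕ) :
    ν i ≤ μ := by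
  have hfix : μ = G.system h μ := hμ.1
  induction i with
  | zero =>
    rw [hν.1, hfix]
    exact G.system_mono h fun _ => zero_le
  | succ i ih =>
    obtain ⟨δ, Δ, hδ, hΔ, hs⟩ := hν.2 i
    rw [hs]
    have hlub := IsLeast.isLUB_iterate (G.diff_omegaCont h (ν i) δ) hΔ
    have hmono := iterate_zero_monotone (F := fun y => G.diff h (ν i) y + δ)
      fun _ _ hxy X => (G.diff_omegaCont h (ν i) δ X).1 hxy
    intro X
    refine (OmegaContinuous.add_isLUB _ _ (ν i X) (fun _ _ hmn => hmono hmn X)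
      (isLUB_range_apply hlub X)).2 ?_
    rintro _ ⟨n, rfl⟩
    have key : ∀ n, ν i + (fun y => G.diff h (ν i) y + δ)^[n] 0 ≤ μ := by
      intro n
      induction n with
      | zero => simpa using ih
      | succ n ihn =>
        rw [Function.iterate_succ_apply', hfix]
        refine le_trans (le_of_eq ?_) ((G.system_add_diff_le h (ν i) _).trans
          (G.system_mono h ihn))
        rw [hδ, add_comm (G.diff h _ _), add_assoc]
    exact key n X

theorem Grammar.IsNewtonSequence.monotone {ν : ℕ → V → S} (hν : G.IsNewtonSequence h ν) :
    Monotone ν :=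
  monotone_nat_of_le_succ fun i => by
    obtain ⟨δ, Δ, -, -, hs⟩ := hν.2 i
    rw [hs]
    exact fun X => le_self_add

end Newton

/-! ### Finite multiplicities -/

section Multiplicity

variable {S : Type*} [CommSemiring S] [PartialOrder S] [CanonicallyOrderedAdd S]

theorem natCast_eq_of_le {k : ℕ} (hS : (k : S) = (k : S) + 1) {n : ℕ} (hn : k ≤ n) :
    (n : S) = (k : S) := by
  induction n, hn using Nat.le_induction with
  | base => rfl
  | succ n _ ih => rw [Nat.cast_succ, ih, ← hS]

theorem natCast_min {k : ℕ} (hS : (k : S) = (k : S) + 1) (n : ℕ) :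
    ((min n k : ℕ) : S) = (n : S) := by
  rcases le_total n k with hn | hn
  · rw [min_eq_left hn]
  · rw [min_eq_right hn, natCast_eq_of_le hS hn]

/-- If `k = k + 1` in `S`, then multiplicities matter only up to `k`. -/
theorem ofENat_eq_natCast [OmegaContinuous S] {k : ℕ} (hS : (k : S) = (k : S) + 1) (c : ℕ∞) :
    (ofENat c : S) = ((min c k).toNat : S) := by
  induction c using ENat.recTopCoe with
  | top =>
    rw [min_eq_right le_top, ENat.toNat_natCast]
    show kstar (1 : S) = k
    have h1 := isLUB_osum fun i : ℕ => (1 : S) ^ i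
    refine h1.unique ⟨?_, fun b hb => ?_⟩
    · rintro _ ⟨F, rfl⟩
      simp only [one_pow, Finset.sum_const, nsmul_eq_mul, mul_one]
      rw [← natCast_min hS]
      exact Nat.mono_cast (min_le_right _ _)
    · simpa using hb ⟨Finset.range k, rfl⟩
  | coe n =>
    show (n : S) = _
    rw [← Monotone.map_min (f := ((↑) : ℕ → ℕ∞)) Nat.mono_cast, ENat.toNat_natCast, natCast_min hS]

theorem ofENat_congr [OmegaContinuous S] {k : ℕ} (hS : (k : S) = (k : S) + 1) {a b : ℕ∞}
    (hab : a ≤ b) (hba : min b k ≤ a) : (ofENat a : S) = ofENat b := by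
  rw [ofENat_eq_natCast hS, ofENat_eq_natCast hS]
  congr 2
  exact le_antisymm (min_le_min_right _ hab) (le_min hba (min_le_right _ _))

end Multiplicity

/-! ### Positions of variables -/

section Pos

variable {A V : Type*}

/-- A position of a word that holds a variable, together with this variable. -/
structure Pos (γ : List (Symbol A V)) where
  idx : Fin γ.length
  var : V
  eq : γ[idx] = Symbol.nonterminal var

namespace Pos

theorem idx_injective {γ : List (Symbol A V)} : Function.Injective (idx : Pos γ → Fin γ.length) := by
  rintro ⟨i, Y, h⟩ ⟨j, Z, h'⟩ (rfl : i = j)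
  rw [h] at h'
  cases h'
  rfl

noncomputable instance (γ : List (Symbol A V)) : Fintype (Pos γ) :=
  Fintype.ofInjective _ idx_injective

noncomputable instance (γ : List (Symbol A V)) : DecidableEq (Pos γ) := Classical.decEq _

instance : IsEmpty (Pos ([] : List (Symbol A V))) := ⟨fun p => p.idx.elim0⟩

/-- The position of the tail as a position of the word. -/
def succ {s : Symbol A V} {γ : List (Symbol A V)} (p : Pos γ) : Pos (s :: γ) :=
  ⟨p.idx.succ, p.var, p.eq⟩

/-- The first position of a word that starts with a variable. -/
def zero {Y : V} {γ : List (Symbol A V)} : Pos (Symbol.nonterminal Y :: γ) :=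
  ⟨⟨0, Nat.succ_pos _⟩, Y, rfl⟩

def equivConsTerminal (a : A) (γ : List (Symbol A V)) : Pos γ ≃ Pos (Symbol.terminal a :: γ) where
  toFun := succ
  invFun
    | ⟨⟨0, _⟩, _, h⟩ => nomatch h
    | ⟨⟨i + 1, hi⟩, Y, h⟩ => ⟨⟨i, Nat.lt_of_succ_lt_succ hi⟩, Y, h⟩
  left_inv _ := rfl
  right_inv
    | ⟨⟨0, _⟩, _, h⟩ => nomatch h
    | ⟨⟨_ + 1, _⟩, _, _⟩ => rfl

def equivConsNonterminal (Y : V) (γ : List (Symbol A V)) :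
    Option (Pos γ) ≃ Pos (Symbol.nonterminal Y :: γ) where
  toFun p := p.elim zero succ
  invFun
    | ⟨⟨0, _⟩, _, _⟩ => none
    | ⟨⟨i + 1, hi⟩, Y, h⟩ => some ⟨⟨i, Nat.lt_of_succ_lt_succ hi⟩, Y, h⟩
  left_inv
    | none => rfl
    | some _ => rfl
  right_inv
    | ⟨⟨0, _⟩, Z, h⟩ => by
      have : Y = Z := Symbol.nonterminal.inj h
      subst this
      rfl
    | ⟨⟨_ + 1, _⟩, _, _⟩ => rfl

@[to_additive]
theorem prod_cons_terminal {M : Type*} [CommMonoid M] {a : A} {γ : List (Symbol A V)}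
    (f : Pos (Symbol.terminal a :: γ) → M) : ∏ p, f p = ∏ p : Pos γ, f p.succ :=
  ((equivConsTerminal a γ).prod_comp f).symm

@[to_additive]
theorem prod_cons_nonterminal {M : Type*} [CommMonoid M] {Y : V} {γ : List (Symbol A V)}
    (f : Pos (Symbol.nonterminal Y :: γ) → M) :
    ∏ p, f p = f zero * ∏ p : Pos γ, f p.succ := by
  rw [← (equivConsNonterminal Y γ).prod_comp f, Fintype.prod_option]
  rfl

theorem succ_ne_zero {Y : V} {γ : List (Symbol A V)} (p : Pos γ) :
    (p.succ : Pos (Symbol.nonterminal Y :: γ)) ≠ zero := fun h =>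
  (Nat.succ_ne_zero p.idx) (congrArg (fun q : Pos (Symbol.nonterminal Y :: γ) => q.idx.val) h)

theorem succ_inj {s : Symbol A V} {γ : List (Symbol A V)} {p q : Pos γ} :
    (p.succ : Pos (s :: γ)) = q.succ ↔ p = q := by
  refine ⟨fun h => idx_injective (Fin.succ_injective _ (congrArg idx h)), fun h => h ▸ rfl⟩

end Pos

/-- The letters of a word over letters and variables. -/
def letters : List (Symbol A V) → Multiset A
  | [] => 0
  | .terminal a :: γ => a ::ₘ letters γ
  | .nonterminal _ :: γ => letters γ

theorem coe_flatten_ofFn (γ : List (Symbol A V))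
    (F : ∀ (i : Fin γ.length) (Y : V), γ[i] = Symbol.nonterminal Y → List A) :
    (((List.ofFn fun i : Fin γ.length =>
      match h : γ[i] with
      | .terminal a => [a]
      | .nonterminal Y => F i Y h).flatten : List A) : Multiset A) =
    letters γ + ∑ p : Pos γ, (F p.idx p.var p.eq : Multiset A) := by
  induction γ with
  | nil => simp [letters]
  | cons s γ ih =>
    rw [List.ofFn_succ, List.flatten_cons, ← Multiset.coe_add]
    have := ih fun i Y h => F i.succ Y h
    cases s with
    | terminal a =>
      rw [Pos.sum_cons_terminal, letters, Multiset.cons_add]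
      exact congrArg (a ::ₘ ·) this
    | nonterminal Y =>
      rw [Pos.sum_cons_nonterminal, letters, add_left_comm]
      exact congrArg (((F ⟨0, Nat.succ_pos _⟩ Y rfl : List A) : Multiset A) + ·) this

variable {S : Type*} [CommSemiring S] (h : A → S)

theorem monoVal_eq_prod (x : V → S) (γ : List (Symbol A V)) :
    monoVal h x γ = ((letters γ).map h).prod * ∏ p : Pos γ, x p.var := by
  induction γ with
  | nil => simp [monoVal, letters]
  | cons s γ ih =>
    cases s with
    | terminal a =>
      rw [monoVal, ih, letters, Multiset.map_cons, Multiset.prod_cons, Pos.prod_cons_terminal,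
        mul_assoc]
      rfl
    | nonterminal Y =>
      rw [monoVal, ih, letters, Pos.prod_cons_nonterminal, mul_left_comm]
      rfl

theorem monoDiff_eq_sum (u x : V → S) (γ : List (Symbol A V)) :
    monoDiff h u x γ = ((letters γ).map h).prod *
      ∑ p : Pos γ, ∏ q : Pos γ, if q = p then x q.var else u q.var := by
  induction γ with
  | nil => simp [monoDiff]
  | cons s γ ih =>
    cases s with
    | terminal a =>
      rw [monoDiff, ih, letters, Multiset.map_cons, Multiset.prod_cons, Pos.sum_cons_terminal,
        mul_assoc]
      simp only [Pos.prod_cons_terminal, Pos.succ_inj]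
      rfl
    | nonterminal Y =>
      rw [monoDiff, ih, letters, Pos.sum_cons_nonterminal, monoVal_eq_prod]
      simp only [Pos.prod_cons_nonterminal, Pos.succ_inj, Pos.succ_ne_zero,
        (Pos.succ_ne_zero _).symm, if_true, if_false]
      rw [mul_add, ← Finset.mul_sum, mul_left_comm (x Y), mul_left_comm (u Y)]
      rfl

end Pos

/-! ### Derivation trees -/

section Trees

variable {A V : Type*} {G : Grammar A V}

namespace DTree

/-- The derivation tree with rule `r` at the root and children `c`. -/
def branch (r : ContextFreeRule A V) (hr : r ∈ G.rules)
    (c : ∀ p : Pos r.output, DTree G p.var) : DTree G r.input :=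
  .node r hr rfl fun i Y h => c ⟨i, Y, h⟩

theorem branch_induction {motive : ∀ X, DTree G X → Prop}
    (branch : ∀ r hr c, (∀ p, motive _ (c p)) → motive _ (branch r hr c)) :
    ∀ {X : V} (t : DTree G X), motive X t
  | _, .node r hr rfl child => branch r hr (fun p => child p.idx p.var p.eq)
      fun p => branch_induction branch (child p.idx p.var p.eq)

theorem branch_injective {r : ContextFreeRule A V} {hr : r ∈ G.rules}
    {c c' : ∀ p : Pos r.output, DTree G p.var} (h : branch r hr c = branch r hr c') : c = c' := by
  simp only [branch, node.injEq, heq_eq_eq, true_and] at h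
  funext p
  exact congrFun (congrFun (congrFun h p.idx) p.var) p.eq

theorem yield_branch (r : ContextFreeRule A V) (hr : r ∈ G.rules)
    (c : ∀ p : Pos r.output, DTree G p.var) :
    ((branch r hr c).yield : Multiset A) =
      letters r.output + ∑ p, ((c p).yield : Multiset A) := by
  rw [branch, yield]
  exact coe_flatten_ofFn r.output fun i Y h => (c ⟨i, Y, h⟩).yield

/-- The multiset of the rules that label the nodes of a derivation tree. -/
noncomputable def rules {X : V} : DTree G X → Multiset (ContextFreeRule A V)
  | .node r _ _ child => r ::ₘ ∑ p : Pos r.output, (child p.idx p.var p.eq).rules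

theorem rules_branch (r : ContextFreeRule A V) (hr : r ∈ G.rules)
    (c : ∀ p : Pos r.output, DTree G p.var) :
    (branch r hr c).rules = r ::ₘ ∑ p, (c p).rules := by
  rw [branch, rules]

theorem yield_eq_sum_rules {X : V} (t : DTree G X) :
    (t.yield : Multiset A) = (t.rules.map fun r => letters r.output).sum := by
  induction t using branch_induction with
  | branch r hr c ih =>
    rw [yield_branch, rules_branch, Multiset.map_cons, Multiset.sum_cons]
    simp only [ih]
    congr 1
    rw [← Multiset.coe_mapAddMonoidHom, map_sum, ← Multiset.coe_sumAddMonoidHom, map_sum]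

theorem parikh_yield_congr [DecidableEq A] {X Y : V} {t : DTree G X} {t' : DTree G Y}
    (h : t.rules = t'.rules) : parikh t.yield = parikh t'.yield := by
  funext a
  simp only [parikh, ← Multiset.coe_count]
  rw [yield_eq_sum_rules, yield_eq_sum_rules, h]

/-- The Newton dimension of a tree is at most `i`: trees of height `0` have Newton dimension `0`;
any other tree has Newton dimension at most `j + 1` iff all its children but one have Newton
dimension at most `j`, and the remaining one at most `j + 1`. -/
def NewtonDimLE {X : V} : DTree G X → ℕ → Prop
  | .node r _ _ child => fun i => IsEmpty (Pos r.output) ∨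
      ∃ j, i = j + 1 ∧ ∃ p : Pos r.output, (child p.idx p.var p.eq).NewtonDimLE (j + 1) ∧
        ∀ q : Pos r.output, q ≠ p → (child q.idx q.var q.eq).NewtonDimLE j

theorem newtonDimLE_branch_iff {r : ContextFreeRule A V} {hr : r ∈ G.rules}
    {c : ∀ p : Pos r.output, DTree G p.var} {i : ℕ} :
    (branch r hr c).NewtonDimLE i ↔ IsEmpty (Pos r.output) ∨
      ∃ j, i = j + 1 ∧ ∃ p, (c p).NewtonDimLE (j + 1) ∧ ∀ q, q ≠ p → (c q).NewtonDimLE j := by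
  rw [branch, NewtonDimLE]

theorem newtonDimLE_branch_zero {r : ContextFreeRule A V} {hr : r ∈ G.rules}
    {c : ∀ p : Pos r.output, DTree G p.var} :
    (branch r hr c).NewtonDimLE 0 ↔ IsEmpty (Pos r.output) := by
  simp [newtonDimLE_branch_iff]

theorem newtonDimLE_branch_succ {r : ContextFreeRule A V} {hr : r ∈ G.rules}
    {c : ∀ p : Pos r.output, DTree G p.var} {j : ℕ} :
    (branch r hr c).NewtonDimLE (j + 1) ↔ IsEmpty (Pos r.output) ∨
      ∃ p, (c p).NewtonDimLE (j + 1) ∧ ∀ q, q ≠ p → (c q).NewtonDimLE j := by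
  simp [newtonDimLE_branch_iff]

theorem NewtonDimLE.mono {X : V} {t : DTree G X} {i j : ℕ} (hij : i ≤ j)
    (h : t.NewtonDimLE i) : t.NewtonDimLE j := by
  revert i j
  induction t using branch_induction with
  | branch r hr c ih =>
    intro i j hij h
    rw [newtonDimLE_branch_iff] at h ⊢
    refine h.imp_right ?_
    rintro ⟨i, rfl, p, hp, hq⟩
    obtain ⟨j, rfl⟩ : ∃ j', j = j' + 1 := ⟨j - 1, by omega⟩
    exact ⟨j, rfl, p, ih p hij hp, fun q hqp => ih q (Nat.le_of_succ_le_succ hij) (hq q hqp)⟩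

open Classical in
/-- The derivation trees of height less than `n`. -/
noncomputable def upTo (G : Grammar A V) : ℕ → ∀ X : V, Finset (DTree G X)
  | 0, _ => ∅
  | n + 1, X => G.rules.attach.biUnion fun r => if hX : r.1.input = X then
      (Fintype.piFinset fun p : Pos r.1.output => upTo G n p.var).image fun c =>
        node r.1 r.2 hX fun i Y h => c ⟨i, Y, h⟩
    else ∅

theorem branch_mem_upTo {r : ContextFreeRule A V} {hr : r ∈ G.rules}
    {c : ∀ p : Pos r.output, DTree G p.var} {n : ℕ} :
    branch r hr c ∈ upTo G (n + 1) r.input ↔ ∀ p, c p ∈ upTo G n p.var := by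
  classical
  simp only [upTo, Finset.mem_biUnion, Finset.mem_attach, true_and]
  constructor
  · rintro ⟨⟨r', hr'⟩, hm⟩
    split_ifs at hm with hX
    · obtain ⟨c', hc', he⟩ := Finset.mem_image.1 hm
      have h1 := he
      simp only [branch, node.injEq] at h1
      obtain ⟨rfl, -⟩ := h1
      obtain rfl := branch_injective he
      exact Fintype.mem_piFinset.1 hc'
    · simp at hm
  · intro hc
    refine ⟨⟨r, hr⟩, ?_⟩
    rw [dif_pos rfl]
    exact Finset.mem_image.2 ⟨c, Fintype.mem_piFinset.2 hc, rfl⟩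

theorem upTo_mono {m n : ℕ} (hmn : m ≤ n) (X : V) : upTo G m X ⊆ upTo G n X := by
  intro t
  revert m n
  induction t using branch_induction with
  | branch r hr c ih =>
    intro m n hmn h
    cases m with
    | zero => simp [upTo] at h
    | succ m =>
      obtain ⟨n, rfl⟩ : ∃ n', n = n' + 1 := ⟨n - 1, by omega⟩
      rw [branch_mem_upTo] at h ⊢
      exact fun p => ih p (Nat.le_of_succ_le_succ hmn) (h p)

theorem exists_mem_upTo {X : V} (t : DTree G X) : ∃ n, t ∈ upTo G n X := by
  induction t using branch_induction with
  | branch r hr c ih =>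
    choose n hn using ih
    exact ⟨Finset.univ.sup n + 1, branch_mem_upTo.2 fun p =>
      upTo_mono (Finset.le_sup (Finset.mem_univ p)) _ (hn p)⟩

theorem exists_subset_upTo {X : V} (F : Finset (DTree G X)) : ∃ n, F ⊆ upTo G n X := by
  choose n hn using exists_mem_upTo (G := G) (X := X)
  exact ⟨F.sup n, fun t ht => upTo_mono (Finset.le_sup ht) _ (hn t)⟩

theorem sum_upTo_succ [DecidableEq V] {M : Type*} [AddCommMonoid M] {n : ℕ} {X : V}
    (g : ∀ X, DTree G X → M)
    (φ : ∀ r : ContextFreeRule A V, (∀ p : Pos r.output, DTree G p.var) → M)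
    (hφ : ∀ r hr c, g r.input (branch r hr c) = φ r c) :
    ∑ t ∈ upTo G (n + 1) X, g X t = ∑ r ∈ G.rules with r.input = X,
      ∑ c ∈ Fintype.piFinset fun p : Pos r.output => upTo G n p.var, φ r c := by
  classical
  rw [upTo, Finset.sum_biUnion, Finset.sum_filter, ← Finset.sum_attach G.rules]
  · refine Finset.sum_congr rfl fun r _ => ?_
    split_ifs with hX
    · obtain ⟨r, hr⟩ := r
      dsimp only at hX
      subst hX
      refine (Finset.sum_image fun c _ c' _ h => branch_injective (hr := hr) h).trans ?_
      exact Finset.sum_congr rfl fun c _ => hφ r hr c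
    · rfl
  · rintro ⟨r, hr⟩ - ⟨r', hr'⟩ - hne
    rw [Function.onFun, Finset.disjoint_left]
    intro t ht ht'
    split_ifs at ht ht' with h1 h2
    · obtain ⟨c, -, rfl⟩ := Finset.mem_image.1 ht
      obtain ⟨c', -, he⟩ := Finset.mem_image.1 ht'
      simp only [node.injEq] at he
      exact hne (Subtype.ext he.1.symm)
    all_goals simp at ht ht'

end DTree

end Trees

/-! ### Sums over derivation trees -/

section Weights

variable {A V S : Type*} [CommSemiring S] {G : Grammar A V} (h : A → S)

namespace DTree

/-- The value of the yield of a derivation tree. -/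
def weight {X : V} (t : DTree G X) : S := ((t.yield : Multiset A).map h).prod

theorem weight_eq_prod [Fintype A] [DecidableEq A] {X : V} (t : DTree G X) :
    t.weight h = ∏ a, h a ^ parikh t.yield a := by
  rw [weight, Finset.prod_multiset_map_count]
  simp only [Multiset.coe_count, parikh]
  refine Finset.prod_subset (Finset.subset_univ (t.yield : Multiset A).toFinset) fun a _ ha => ?_
  rw [List.count_eq_zero_of_not_mem (by simpa using ha), pow_zero]

theorem weight_branch (r : ContextFreeRule A V) (hr : r ∈ G.rules)
    (c : ∀ p : Pos r.output, DTree G p.var) :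
    (branch r hr c).weight h = ((letters r.output).map h).prod * ∏ p, (c p).weight h := by
  rw [weight, yield_branch, Multiset.map_add, Multiset.prod_add]
  congr 1
  rw [← Multiset.coe_mapAddMonoidHom, map_sum, Multiset.prod_sum]
  rfl

variable [DecidableEq V]

theorem sum_upTo_weight (n : ℕ) :
    (fun X => ∑ t ∈ upTo G n X, t.weight h) = (G.system h)^[n] 0 := by
  induction n with
  | zero => funext X; simp [upTo]
  | succ n ih =>
    rw [Function.iterate_succ_apply', ← ih]
    funext X
    rw [sum_upTo_succ (fun X t => t.weight h)
      (fun r c => ((letters r.output).map h).prod * ∏ p, (c p).weight h)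
      (fun r hr c => weight_branch h r hr c), Grammar.system]
    refine Finset.sum_congr rfl fun r _ => ?_
    rw [monoVal_eq_prod, ← Finset.mul_sum, Finset.prod_univ_sum]

open Classical in
/-- The sum over the derivation trees of height less than `n` with root `X` that satisfy `P`. -/
noncomputable def sumUpTo (G : Grammar A V) (h : A → S) (P : ∀ X, DTree G X → Prop) (n : ℕ)
    (X : V) : S :=
  ∑ t ∈ upTo G n X, if P X t then t.weight h else 0

variable [PartialOrder S] [CanonicallyOrderedAdd S]

theorem sumUpTo_newtonDimLE_zero_le (n : ℕ) :
    sumUpTo G h (fun _ t => t.NewtonDimLE 0) n ≤ G.system h 0 := by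
  classical
  intro X
  cases n with
  | zero => simp [sumUpTo, upTo]
  | succ n =>
    rw [sumUpTo, sum_upTo_succ (fun X t => if t.NewtonDimLE 0 then t.weight h else 0)
      (fun r c => if IsEmpty (Pos r.output) then
        ((letters r.output).map h).prod * ∏ p, (c p).weight h else 0)
      (fun r hr c => by simp only [newtonDimLE_branch_zero, weight_branch]), Grammar.system]
    refine Finset.sum_le_sum fun r _ => ?_
    rw [monoVal_eq_prod]
    split_ifs with he
    · rw [← Finset.mul_sum, ← Finset.prod_univ_sum (fun p : Pos r.output => upTo G n p.var)
        fun p t => t.weight h]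
      simp
    · simp

theorem sumUpTo_newtonDimLE_succ_le (i n : ℕ) :
    sumUpTo G h (fun _ t => t.NewtonDimLE (i + 1)) (n + 1) ≤
      G.system h (sumUpTo G h (fun _ t => t.NewtonDimLE i) n) +
      G.diff h (sumUpTo G h (fun _ t => t.NewtonDimLE i) n)
        (sumUpTo G h (fun _ t => t.NewtonDimLE (i + 1) ∧ ¬ t.NewtonDimLE i) n) := by
  classical
  intro X
  rw [sumUpTo, sum_upTo_succ (fun X t => if t.NewtonDimLE (i + 1) then t.weight h else 0)
    (fun r c => if IsEmpty (Pos r.output) ∨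
        ∃ p, (c p).NewtonDimLE (i + 1) ∧ ∀ q, q ≠ p → (c q).NewtonDimLE i then
      ((letters r.output).map h).prod * ∏ p, (c p).weight h else 0)
    (fun r hr c => by simp only [newtonDimLE_branch_succ, weight_branch])]
  simp only [Pi.add_apply, Grammar.system, Grammar.diff]
  rw [← Finset.sum_add_distrib]
  refine Finset.sum_le_sum fun r _ => ?_
  rw [monoVal_eq_prod, monoDiff_eq_sum, ← mul_add]
  set T := fun p : Pos r.output => upTo G n p.var
  let a : ∀ p : Pos r.output, DTree G p.var → S := fun p t =>
    if t.NewtonDimLE i then t.weight h else 0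
  let b : ∀ p : Pos r.output, DTree G p.var → S := fun p t =>
    if t.NewtonDimLE (i + 1) ∧ ¬ t.NewtonDimLE i then t.weight h else 0
  have e1 : ∏ p : Pos r.output, sumUpTo G h (fun _ t => t.NewtonDimLE i) n p.var =
      ∑ c ∈ Fintype.piFinset T, ∏ p, a p (c p) := Finset.prod_univ_sum T a
  have e2 : ∀ p : Pos r.output, (∏ q : Pos r.output, if q = p then
      sumUpTo G h (fun _ t => t.NewtonDimLE (i + 1) ∧ ¬ t.NewtonDimLE i) n q.var else
      sumUpTo G h (fun _ t => t.NewtonDimLE i) n q.var) =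
      ∑ c ∈ Fintype.piFinset T, ∏ q, if q = p then b q (c q) else a q (c q) := by
    intro p
    rw [← Finset.prod_univ_sum T fun q t => if q = p then b q t else a q t]
    refine Finset.prod_congr rfl fun q _ => ?_
    split_ifs
    · exact Finset.sum_congr rfl fun t _ => by congr
    · rfl
  rw [e1, Finset.sum_congr rfl fun p _ => e2 p, Finset.sum_comm, ← Finset.sum_add_distrib,
    Finset.mul_sum]
  refine Finset.sum_le_sum fun c _ => ?_
  split_ifs with hc
  swap
  · exact zero_le
  refine mul_le_mul' le_rfl ?_
  by_cases hall : ∀ p, (c p).NewtonDimLE i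
  · refine le_trans (le_of_eq (Finset.prod_congr rfl fun p _ => ?_)) le_self_add
    exact (if_pos (hall p)).symm
  · obtain he | ⟨p, hp, hq⟩ := hc
    · exact absurd (fun p => he.elim p) hall
    · have hp' : ¬ (c p).NewtonDimLE i := fun hp' => hall fun q => by
        by_cases hqp : q = p
        · exact hqp ▸ hp'
        · exact hq q hqp
      refine le_trans (le_trans (le_of_eq ?_) (Finset.single_le_sum (fun _ _ => zero_le)
        (Finset.mem_univ p))) le_add_self
      refine Finset.prod_congr rfl fun q _ => ?_
      split_ifs with hqp
      · subst hqp
        exact (if_pos ⟨hp, hp'⟩).symm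
      · exact (if_pos (hq q hqp)).symm

/-- The `i`-th Newton approximant dominates the trees of Newton dimension at most `i`. -/
theorem sumUpTo_le_newton {ν : ℕ → V → S} (hν : G.IsNewtonSequence h ν) (i n : ℕ) :
    sumUpTo G h (fun _ t => t.NewtonDimLE i) n ≤ ν i := by
  classical
  revert n
  induction i with
  | zero => exact fun n => hν.1 ▸ sumUpTo_newtonDimLE_zero_le h n
  | succ i ih =>
    intro n
    induction n with
    | zero => intro X; simp [sumUpTo, upTo]
    | succ n ihn =>
      obtain ⟨δ, Δ, hδ, hΔ, hs⟩ := hν.2 i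
      refine (sumUpTo_newtonDimLE_succ_le h i n).trans ?_
      rw [hs] at ihn ⊢
      rw [newton_step_eq hδ hΔ]
      refine G.system_add_diff_mono h (ih n) (le_trans (le_of_eq ?_) ihn)
      funext X
      simp only [Pi.add_apply, sumUpTo, ← Finset.sum_add_distrib]
      refine Finset.sum_congr rfl fun t _ => ?_
      by_cases h1 : t.NewtonDimLE i
      · simp [h1, h1.mono i.le_succ]
      · simp [h1]

theorem sum_weight_le_newton {ν : ℕ → V → S} (hν : G.IsNewtonSequence h ν) {i : ℕ} {X : V}
    {F : Finset (DTree G X)} (hF : ∀ t ∈ F, t.NewtonDimLE i) :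
    ∑ t ∈ F, t.weight h ≤ ν i X := by
  classical
  obtain ⟨n, hn⟩ := exists_subset_upTo F
  refine le_trans ?_ (sumUpTo_le_newton h hν i n X)
  refine le_trans (le_of_eq ?_) (Finset.sum_le_sum_of_subset hn)
  exact Finset.sum_congr rfl fun t ht => (if_pos (hF t ht)).symm

end DTree

variable [PartialOrder S] [CanonicallyOrderedAdd S] [OmegaContinuous S] [DecidableEq A]
  [Fintype A]

/-- If every vector has as many trees in `P` as it has trees, up to the multiplicity `k`, then
bounds for the sums over trees in `P` are bounds for the commutative ambiguity. -/
theorem evalSeries_camb_le {k : ℕ} (hS : (k : S) = (k : S) + 1) {X : V}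
    {P : DTree G X → Prop} {b : S}
    (hP : ∀ v, min (camb G X v) k ≤ {t : DTree G X | P t ∧ parikh t.yield = v}.encard)
    (hb : ∀ F : Finset (DTree G X), (∀ t ∈ F, P t) → ∑ t ∈ F, t.weight h ≤ b) :
    evalSeries h (camb G X) ≤ b := by
  classical
  have hF : ∀ v, ∃ F : Finset (DTree G X), (∀ t ∈ F, P t ∧ parikh t.yield = v) ∧
      (F.card : ℕ∞) = min (camb G X v) k := by
    intro v
    obtain ⟨T, hT, hc⟩ := Set.exists_subset_encard_eq (hP v)
    have hfin : T.Finite := Set.finite_of_encard_le_coe (hc.trans_le (min_le_right _ _))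
    refine ⟨hfin.toFinset, fun t ht => hT (hfin.mem_toFinset.1 ht), ?_⟩
    rw [← hc, hfin.encard_eq_coe_toFinset_card]
  choose F hFP hFc using hF
  refine (isLUB_osum _).2 ?_
  rintro _ ⟨U, rfl⟩
  have hterm : ∀ v, (ofENat (camb G X v) : S) * ∏ a, h a ^ v a = ∑ t ∈ F v, t.weight h := by
    intro v
    rw [Finset.sum_congr rfl fun t ht => by rw [DTree.weight_eq_prod, (hFP v t ht).2],
      Finset.sum_const, nsmul_eq_mul, ofENat_eq_natCast hS, ← hFc, ENat.toNat_natCast]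
  refine le_trans (le_of_eq ?_) (hb (U.biUnion F) fun t ht => ?_)
  · rw [Finset.sum_biUnion]
    · exact Finset.sum_congr rfl fun v _ => hterm v
    · intro v _ v' _ hne
      exact Finset.disjoint_left.2 fun t ht ht' =>
        hne ((hFP v t ht).2.symm.trans (hFP v' t ht').2)
  · obtain ⟨v, -, hv⟩ := Finset.mem_biUnion.1 ht
    exact (hFP v t hv).1

theorem sum_weight_le_evalSeries {k : ℕ} (hS : (k : S) = (k : S) + 1) {X : V}
    (F : Finset (DTree G X)) : ∑ t ∈ F, t.weight h ≤ evalSeries h (camb G X) := by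
  classical
  refine le_trans ?_ ((isLUB_osum _).1 ⟨F.image fun t => parikh t.yield, rfl⟩)
  rw [← Finset.sum_fiberwise_of_maps_to (g := fun t => parikh t.yield)
    fun t ht => Finset.mem_image_of_mem (fun t : DTree G X => parikh t.yield) ht]
  refine Finset.sum_le_sum fun v _ => ?_
  rw [Finset.sum_congr rfl fun t ht => by
    rw [DTree.weight_eq_prod, (Finset.mem_filter.1 ht).2], Finset.sum_const, nsmul_eq_mul]
  refine mul_le_mul' ?_ le_rfl
  rw [ofENat_eq_natCast hS, ← natCast_min hS]
  refine Nat.mono_cast ?_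
  rw [← ENat.natCast_le_natCast, ENat.natCast_toNat (ne_top_of_le_ne_top (ENat.natCast_ne_top k)
    (min_le_right _ _)), Monotone.map_min (f := ((↑) : ℕ → ℕ∞)) Nat.mono_cast]
  refine min_le_min_right _ ?_
  rw [← Set.encard_coe_eq_coe_finsetCard]
  exact Set.encard_le_encard fun t ht => (Finset.mem_filter.1 ht).2

/-- The least solution is the valuation of the commutative ambiguity. -/
theorem isLeastSolution_evalSeries_camb [DecidableEq V] {k : ℕ} (hS : (k : S) = (k : S) + 1) :
    G.IsLeastSolution h fun X => evalSeries h (camb G X) := by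
  refine isLeast_of_isLUB_iterate (G.system_omegaCont h) (isLUB_range_of_apply fun X => ⟨?_, ?_⟩)
  · rintro _ ⟨n, rfl⟩
    dsimp only
    rw [← DTree.sum_upTo_weight]
    exact sum_weight_le_evalSeries h hS _
  · intro b hb
    refine evalSeries_camb_le h hS (P := fun _ => True) (fun v => ?_) fun F _ => ?_
    · simp only [true_and]
      exact min_le_left _ _
    · obtain ⟨n, hn⟩ := DTree.exists_subset_upTo F
      refine (Finset.sum_le_sum_of_subset hn).trans (hb ⟨n, ?_⟩)
      dsimp only
      rw [← DTree.sum_upTo_weight]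

end Weights

/-! ### Rearranging derivation trees -/

namespace DTree

section Rearrange

variable {A V : Type*} {G : Grammar A V}

theorem rules_branch_congr {r : ContextFreeRule A V} {hr : r ∈ G.rules}
    {c c' : ∀ p : Pos r.output, DTree G p.var} (h : ∀ p, (c' p).rules = (c p).rules) :
    (branch r hr c').rules = (branch r hr c).rules := by
  simp only [rules_branch, h]

theorem sum_rules_update {γ : List (Symbol A V)} (c : ∀ p : Pos γ, DTree G p.var) (p : Pos γ)
    (u : DTree G p.var) :
    ∑ q, (Function.update c p u q).rules + (c p).rules = ∑ q, (c q).rules + u.rules := by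
  rw [← Finset.add_sum_erase _ _ (Finset.mem_univ p),
    ← Finset.add_sum_erase (a := p) _ (fun q => (c q).rules) (Finset.mem_univ p),
    Function.update_self, Finset.sum_congr rfl fun q hq => by
      rw [Function.update_of_ne (Finset.ne_of_mem_erase hq)]]
  abel

/-- `Sub s t` says that `s` is a subtree of `t`. -/
inductive Sub {Z : V} (s : DTree G Z) : ∀ {X : V}, DTree G X → Prop
  | refl : Sub s s
  | child {r : ContextFreeRule A V} {hr : r ∈ G.rules} {c : ∀ p : Pos r.output, DTree G p.var}
      (p : Pos r.output) : Sub s (c p) → Sub s (branch r hr c)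

theorem rules_lt_branch {r : ContextFreeRule A V} {hr : r ∈ G.rules}
    {c : ∀ p : Pos r.output, DTree G p.var} (p : Pos r.output) :
    (c p).rules < (branch r hr c).rules := by
  rw [rules_branch]
  exact (Finset.single_le_sum (f := fun p => (c p).rules) (fun _ _ => Multiset.zero_le _)
    (Finset.mem_univ p)).trans_lt (Multiset.lt_cons_self _ _)

theorem Sub.rules_le {X Z : V} {s : DTree G Z} {t : DTree G X} (h : Sub s t) :
    s.rules ≤ t.rules := by
  induction h with
  | refl => exact le_rfl
  | child p _ ih => exact ih.trans (rules_lt_branch p).le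

theorem Sub.replace {X Z : V} {s : DTree G Z} {t : DTree G X} (h : Sub s t) (s' : DTree G Z) :
    ∃ t' : DTree G X, t'.rules + s.rules = t.rules + s'.rules := by
  induction h with
  | refl => exact ⟨s', add_comm _ _⟩
  | @child r hr c p _ ih =>
    obtain ⟨u, hu⟩ := ih
    refine ⟨branch r hr (Function.update c p u), ?_⟩
    have h1 := sum_rules_update c p u
    rw [rules_branch, rules_branch, Multiset.cons_add, Multiset.cons_add]
    congr 1
    refine add_right_cancel (b := (c p).rules) ?_
    rw [add_right_comm, h1, add_assoc, hu]
    abel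

/-- A tree is pumpable if it contains a subtree together with a smaller subtree of that subtree
that has the same root variable. -/
def Pumpable {X : V} (t : DTree G X) : Prop :=
  ∃ (Z : V) (s s' : DTree G Z), Sub s t ∧ Sub s' s ∧ s'.rules < s.rules

theorem Pumpable.branch {r : ContextFreeRule A V} {hr : r ∈ G.rules}
    {c : ∀ p : Pos r.output, DTree G p.var} {p : Pos r.output} (h : (c p).Pumpable) :
    (branch r hr c).Pumpable :=
  let ⟨Z, s, s', hs, hs', hlt⟩ := h
  ⟨Z, s, s', hs.child p, hs', hlt⟩

variable [DecidableEq V]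

/-- The variables that occur in a derivation tree. -/
noncomputable def vars {X : V} (t : DTree G X) : Finset V :=
  (t.rules.map ContextFreeRule.input).toFinset

theorem mem_vars {X Z : V} {t : DTree G X} : Z ∈ t.vars ↔ ∃ x ∈ t.rules, x.input = Z := by
  simp [vars]

theorem vars_mono {X Y : V} {t : DTree G X} {t' : DTree G Y} (h : t.rules ≤ t'.rules) :
    t.vars ⊆ t'.vars := fun _ hZ =>
  let ⟨x, hx, he⟩ := mem_vars.1 hZ
  mem_vars.2 ⟨x, Multiset.mem_of_le h hx, he⟩

theorem root_mem_vars {X : V} (t : DTree G X) : X ∈ t.vars := by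
  induction t using branch_induction with
  | branch r hr c _ => exact mem_vars.2 ⟨r, by simp [rules_branch], rfl⟩

theorem exists_sub_of_mem_vars {X Z : V} {t : DTree G X} (h : Z ∈ t.vars) :
    ∃ s : DTree G Z, Sub s t := by
  induction t using branch_induction with
  | branch r hr c ih =>
    obtain ⟨x, hx, rfl⟩ := mem_vars.1 h
    rw [rules_branch, Multiset.mem_cons, Multiset.mem_sum] at hx
    obtain rfl | ⟨p, -, hp⟩ := hx
    · exact ⟨_, .refl⟩
    · obtain ⟨s, hs⟩ := ih p (mem_vars.2 ⟨x, hp, rfl⟩)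
      exact ⟨s, hs.child p⟩

/-- A tree that is not pumpable has small height and hence small Newton dimension. -/
theorem newtonDimLE_of_not_pumpable {X : V} {t : DTree G X} (ht : ¬ t.Pumpable) {j : ℕ}
    (hj : t.vars.card ≤ j + 1) : t.NewtonDimLE j := by
  revert j
  induction t using branch_induction with
  | branch r hr c ih =>
    intro j hj
    rw [newtonDimLE_branch_iff]
    by_cases he : IsEmpty (Pos r.output)
    · exact .inl he
    obtain ⟨p₀⟩ := not_isEmpty_iff.1 he
    have hlt : ∀ p, (c p).vars.card < (branch r hr c).vars.card := fun p => by
      refine Finset.card_lt_card ⟨vars_mono (rules_lt_branch p).le, fun hsub => ?_⟩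
      obtain ⟨s, hs⟩ := exists_sub_of_mem_vars (hsub (root_mem_vars _))
      exact ht ⟨_, _, s, .refl, hs.child p, hs.rules_le.trans_lt (rules_lt_branch p)⟩
    have h0 := hlt p₀
    have h1 : 0 < (c p₀).vars.card := Finset.card_pos.2 ⟨_, root_mem_vars _⟩
    obtain ⟨j, rfl⟩ : ∃ j', j = j' + 1 := ⟨j - 1, by omega⟩
    have h2 : ∀ p, (c p).NewtonDimLE j := fun p =>
      ih p (fun h => ht h.branch) (Nat.le_of_lt_succ ((hlt p).trans_le hj))
    exact .inr ⟨j, rfl, p₀, (h2 p₀).mono j.le_succ, fun q _ => h2 q⟩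

theorem Pumpable.exists_move {X Y : V} {t₁ : DTree G X} {t₂ : DTree G Y} (h : t₁.Pumpable)
    (hsub : t₁.vars ⊆ t₂.vars) : ∃ (t₁' : DTree G X) (t₂' : DTree G Y),
      t₁'.rules + t₂'.rules = t₁.rules + t₂.rules ∧ t₁'.rules < t₁.rules := by
  obtain ⟨Z, s, s', hs, hs', hlt⟩ := h
  obtain ⟨q, hq⟩ := exists_sub_of_mem_vars (hsub (vars_mono hs.rules_le (root_mem_vars s)))
  obtain ⟨t₁', h1⟩ := hs.replace s'
  obtain ⟨w, hw⟩ := hs'.replace q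
  obtain ⟨t₂', h2⟩ := hq.replace w
  refine ⟨t₁', t₂', ?_, ?_⟩
  · refine add_right_cancel (b := s.rules + q.rules + s'.rules) ?_
    calc t₁'.rules + t₂'.rules + (s.rules + q.rules + s'.rules)
        = (t₁'.rules + s.rules) + (t₂'.rules + q.rules) + s'.rules := by abel
      _ = (t₁.rules + s'.rules) + t₂.rules + (w.rules + s'.rules) := by rw [h1, h2]; abel
      _ = _ := by rw [hw]; abel
  · refine lt_of_add_lt_add_right (a := s.rules) ?_
    rw [h1]
    gcongr

theorem rules_le_of_add_eq {W X Y Z : V} {t₁ : DTree G W} {t₂ : DTree G X} {t₁' : DTree G Y}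
    {t₂' : DTree G Z} (h : t₁'.rules + t₂'.rules = t₁.rules + t₂.rules)
    (hle : t₁'.rules ≤ t₁.rules) : t₂.rules ≤ t₂'.rules := by
  refine le_of_add_le_add_left (a := t₁'.rules) ?_
  rw [h]
  gcongr

theorem exists_drain {X Y : V} (t₁ : DTree G X) (t₂ : DTree G Y) (hsub : t₁.vars ⊆ t₂.vars) :
    ∃ (t₁' : DTree G X) (t₂' : DTree G Y), t₁'.rules + t₂'.rules = t₁.rules + t₂.rules ∧
      ¬ t₁'.Pumpable ∧ t₁'.rules ≤ t₁.rules ∧ (t₁.Pumpable → t₁'.rules < t₁.rules) := by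
  induction hn : t₁.rules using Multiset.strongInductionOn generalizing t₁ t₂ with
  | ih R ih =>
    subst hn
    by_cases hp : t₁.Pumpable
    · obtain ⟨u₁, u₂, hu, hlt⟩ := hp.exists_move hsub
      obtain ⟨t₁', t₂', h1, h2, h3, -⟩ := ih _ hlt u₁ u₂ (((vars_mono hlt.le).trans hsub).trans
        (vars_mono (rules_le_of_add_eq hu hlt.le))) rfl
      exact ⟨t₁', t₂', h1.trans hu, h2, h3.trans hlt.le, fun _ => h3.trans_lt hlt⟩
    · exact ⟨t₁, t₂, rfl, hp, le_rfl, fun h => absurd h hp⟩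

/-- All pumps of the trees at the positions `Q` can be moved into the tree at position `g`. -/
theorem exists_gather {γ : List (Symbol A V)} (c : ∀ p : Pos γ, DTree G p.var) (g : Pos γ)
    (Q : Finset (Pos γ)) (hg : g ∉ Q) (hQ : ∀ p ∈ Q, (c p).vars ⊆ (c g).vars) :
    ∃ c' : ∀ p : Pos γ, DTree G p.var, ∑ p, (c' p).rules = ∑ p, (c p).rules ∧
      (∀ p ∈ Q, ¬ (c' p).Pumpable ∧ (c' p).rules ≤ (c p).rules ∧
        ((c p).Pumpable → (c' p).rules < (c p).rules)) ∧
      (∀ p ∉ Q, p ≠ g → c' p = c p) ∧ (c g).rules ≤ (c' g).rules := by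
  induction Q using Finset.induction_on with
  | empty => exact ⟨c, rfl, by simp, fun _ _ _ => rfl, le_rfl⟩
  | insert a Q ha ih =>
    simp only [Finset.mem_insert, not_or] at hg
    obtain ⟨c', h1, h2, h3, h4⟩ := ih hg.2 fun p hp => hQ p (Finset.mem_insert_of_mem hp)
    have hag : a ≠ g := fun h => hg.1 h.symm
    have hca : c' a = c a := h3 a ha hag
    obtain ⟨u, v, huv, hu, hle, hlt⟩ := exists_drain (c' a) (c' g)
      (hca ▸ (hQ a (Finset.mem_insert_self _ _)).trans (vars_mono h4))
    refine ⟨Function.update (Function.update c' a u) g v, ?_, ?_, ?_, ?_⟩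
    · have e1 := sum_rules_update c' a u
      have e2 := sum_rules_update (Function.update c' a u) g v
      rw [Function.update_of_ne hag.symm] at e2
      rw [← h1]
      refine add_right_cancel (b := (c' g).rules + (c' a).rules) ?_
      rw [← add_assoc, e2, add_right_comm, e1, add_assoc, huv]
      abel
    · intro p hp
      obtain rfl | hp := Finset.mem_insert.1 hp
      · rw [Function.update_of_ne hag, Function.update_self, ← hca]
        exact ⟨hu, hle, hlt⟩
      · have hpg : p ≠ g := fun h => hg.2 (h ▸ hp)
        have hpa : p ≠ a := fun h => ha (h ▸ hp)
        rw [Function.update_of_ne hpg, Function.update_of_ne hpa]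
        exact h2 p hp
    · intro p hp hpg
      simp only [Finset.mem_insert, not_or] at hp
      rw [Function.update_of_ne hpg, Function.update_of_ne hp.1]
      exact h3 p hp.2 hpg
    · rw [Function.update_self]
      exact h4.trans (rules_le_of_add_eq huv hle)

theorem card_vars_le_of_ne {X : V} {t : DTree G X} {W : Finset V} {l : ℕ} (hW : W.card ≤ l + 1)
    (hsub : t.vars ⊆ W) (hne : t.vars ≠ W) : t.vars.card ≤ l :=
  Nat.le_of_lt_succ ((Finset.card_lt_card (hsub.ssubset_of_ne hne)).trans_le hW)

theorem vars_subset_of_sum {γ : List (Symbol A V)} {c : ∀ p : Pos γ, DTree G p.var}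
    {W : Finset V} (hW : ∀ x ∈ ∑ p, (c p).rules, x.input ∈ W) (p : Pos γ) : (c p).vars ⊆ W := by
  intro Z hZ
  obtain ⟨x, hx, rfl⟩ := mem_vars.1 hZ
  exact hW x (Multiset.mem_sum.2 ⟨p, Finset.mem_univ p, hx⟩)

/-- If small trees can be rearranged to have Newton dimension at most the number of their
variables, then the trees at the positions `Q` can be rearranged so that at most one of them has
as large a Newton dimension as the number of all variables. -/
theorem exists_rearrange_on {γ : List (Symbol A V)} (c : ∀ p : Pos γ, DTree G p.var)
    (Q : Finset (Pos γ)) (p₀ : Pos γ) {W : Finset V} {l : ℕ} (hl : W.card ≤ l + 1)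
    (hW : ∀ x ∈ ∑ p, (c p).rules, x.input ∈ W)
    (IH : ∀ (Y : V) (s : DTree G Y), s.rules ≤ ∑ p, (c p).rules →
      ∃ s' : DTree G Y, s'.rules = s.rules ∧ s'.NewtonDimLE s.vars.card) :
    ∃ c' : ∀ p : Pos γ, DTree G p.var, ∑ p, (c' p).rules = ∑ p, (c p).rules ∧
      (∀ p ∉ Q, c' p = c p) ∧
      ∃ g, (g ∈ Q → (c' g).NewtonDimLE (l + 1)) ∧
        ∀ p ∈ Q, p ≠ g → (c' p).NewtonDimLE l := by
  classical
  have hle : ∀ (c : ∀ p : Pos γ, DTree G p.var) (p : Pos γ), (c p).rules ≤ ∑ p, (c p).rules :=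
    fun c p => Finset.single_le_sum (f := fun p => (c p).rules) (fun _ _ => Multiset.zero_le _)
      (Finset.mem_univ p)
  by_cases hex : ∃ g ∈ Q, (c g).vars = W
  · obtain ⟨g, hgQ, hg⟩ := hex
    obtain ⟨c₁, h1, h2, h3, h4⟩ := exists_gather c g (Q.erase g) (Finset.notMem_erase _ _)
      fun p _ => hg ▸ vars_subset_of_sum hW p
    have hsub := vars_subset_of_sum (h1.symm ▸ hW)
    obtain ⟨s, hs, hsd⟩ := IH _ (c₁ g) ((hle c₁ g).trans_eq h1)
    refine ⟨Function.update c₁ g s, ?_, fun p hp => ?_, g, fun _ => ?_, fun p hp hpg => ?_⟩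
    · have := sum_rules_update c₁ g s
      rw [hs] at this
      rw [← h1]
      exact add_right_cancel this
    · have hpg : p ≠ g := fun h => hp (h ▸ hgQ)
      rw [Function.update_of_ne hpg]
      exact h3 p (fun h => hp (Finset.mem_of_mem_erase h)) hpg
    · rw [Function.update_self]
      exact hsd.mono ((Finset.card_le_card (hsub g)).trans hl)
    · rw [Function.update_of_ne hpg]
      exact newtonDimLE_of_not_pumpable (h2 p (Finset.mem_erase.2 ⟨hpg, hp⟩)).1
        ((Finset.card_le_card (hsub p)).trans hl)
  · push Not at hex
    choose s hs hsd using fun p => IH _ (c p) (hle c p)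
    have h1 : ∀ p ∈ Q, (s p).NewtonDimLE l := fun p hp =>
      (hsd p).mono (card_vars_le_of_ne hl (vars_subset_of_sum hW p) (hex p hp))
    refine ⟨fun p => if p ∈ Q then s p else c p, ?_, fun p hp => if_neg hp, p₀, fun hp => ?_,
      fun p hp _ => ?_⟩
    · refine Finset.sum_congr rfl fun p _ => ?_
      dsimp only
      split_ifs
      · exact hs p
      · rfl
    · simp only [if_pos hp]
      exact (h1 _ hp).mono l.le_succ
    · simp only [if_pos hp]
      exact h1 p hp

theorem input_mem_vars_branch {r : ContextFreeRule A V} {hr : r ∈ G.rules}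
    {c : ∀ p : Pos r.output, DTree G p.var} :
    ∀ x ∈ ∑ p, (c p).rules, x.input ∈ (branch r hr c).vars := fun x hx =>
  mem_vars.2 ⟨x, by rw [rules_branch]; exact Multiset.mem_cons_of_mem hx, rfl⟩

/-- Every tree can be rearranged to have Newton dimension at most the number of its variables. -/
theorem exists_newtonDimLE {X : V} (t : DTree G X) :
    ∃ t' : DTree G X, t'.rules = t.rules ∧ t'.NewtonDimLE t.vars.card := by
  induction hn : t.rules using Multiset.strongInductionOn generalizing X t with
  | ih R ih =>
    subst hn
    induction t using branch_induction with
    | branch r hr c _ =>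
      by_cases he : IsEmpty (Pos r.output)
      · exact ⟨_, rfl, newtonDimLE_branch_iff.2 (.inl he)⟩
      obtain ⟨p₀⟩ := not_isEmpty_iff.1 he
      obtain ⟨l, hl⟩ : ∃ l, (branch r hr c).vars.card = l + 1 :=
        Nat.exists_eq_succ_of_ne_zero (Finset.card_pos.2 ⟨_, root_mem_vars _⟩).ne'
      obtain ⟨c', h1, -, g, hg, h2⟩ := exists_rearrange_on c Finset.univ p₀ hl.le
        input_mem_vars_branch fun Y s hs => ih _ (hs.trans_lt (by
          rw [rules_branch]; exact Multiset.lt_cons_self _ _)) s rfl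
      refine ⟨branch r hr c', by rw [rules_branch, rules_branch, h1], ?_⟩
      rw [hl, newtonDimLE_branch_succ]
      exact .inr ⟨g, hg (Finset.mem_univ _), fun p hp => h2 p (Finset.mem_univ _) hp⟩

theorem exists_concentrate {r : ContextFreeRule A V} {hr : r ∈ G.rules}
    (c : ∀ p : Pos r.output, DTree G p.var) {l : ℕ} (hl : (branch r hr c).vars.card = l + 1)
    {g : Pos r.output} (hg : (c g).vars = (branch r hr c).vars) :
    ∃ c' : ∀ p : Pos r.output, DTree G p.var,
      (branch r hr c').rules = (branch r hr c).rules ∧ (branch r hr c').NewtonDimLE (l + 1) ∧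
      (c g).rules ≤ (c' g).rules ∧
      ∀ p, p ≠ g → (c p).Pumpable → (c' p).rules < (c p).rules := by
  obtain ⟨c₁, h1, h2, -, h4⟩ := exists_gather c g (Finset.univ.erase g) (Finset.notMem_erase _ _)
    fun p _ => hg ▸ vars_mono (rules_lt_branch p).le
  have hsub := vars_subset_of_sum (h1.symm ▸ input_mem_vars_branch (hr := hr) (c := c))
  obtain ⟨s, hs, hsd⟩ := exists_newtonDimLE (c₁ g)
  have hmem : ∀ p, p ≠ g → p ∈ Finset.univ.erase g := fun p hp =>
    Finset.mem_erase.2 ⟨hp, Finset.mem_univ _⟩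
  refine ⟨Function.update c₁ g s, ?_, ?_, ?_, fun p hp => ?_⟩
  · have := sum_rules_update c₁ g s
    rw [hs] at this
    rw [rules_branch, rules_branch, add_right_cancel this, h1]
  · rw [newtonDimLE_branch_succ]
    refine .inr ⟨g, ?_, fun p hp => ?_⟩
    · rw [Function.update_self]
      exact hsd.mono ((Finset.card_le_card (hsub g)).trans hl.le)
    · rw [Function.update_of_ne hp]
      exact newtonDimLE_of_not_pumpable (h2 p (hmem p hp)).1
        ((Finset.card_le_card (hsub p)).trans hl.le)
  · rw [Function.update_self, hs]
    exact h4
  · rw [Function.update_of_ne hp]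
    exact (h2 p (hmem p hp)).2.2

/-- A tree of Newton dimension larger than the number of its variables has two rearrangements
of Newton dimension at most this number. -/
theorem exists_two_newtonDimLE {X : V} (t : DTree G X) (ht : ¬ t.NewtonDimLE t.vars.card) :
    ∃ t₁ t₂ : DTree G X, t₁ ≠ t₂ ∧ (t₁.rules = t.rules ∧ t₁.NewtonDimLE t.vars.card) ∧
      (t₂.rules = t.rules ∧ t₂.NewtonDimLE t.vars.card) := by
  classical
  induction t using branch_induction with
  | branch r hr c ih =>
    obtain ⟨l, hl⟩ : ∃ l, (branch r hr c).vars.card = l + 1 :=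
      Nat.exists_eq_succ_of_ne_zero (Finset.card_pos.2 ⟨_, root_mem_vars _⟩).ne'
    have hsub : ∀ p, (c p).vars ⊆ (branch r hr c).vars := fun p =>
      vars_mono (rules_lt_branch p).le
    rw [hl] at ht ⊢
    by_cases hC : ∃ a b, a ≠ b ∧ ((c a).vars = (branch r hr c).vars ∧ (c a).Pumpable) ∧
        (c b).vars = (branch r hr c).vars
    · obtain ⟨a, b, hab, ⟨ha, hap⟩, hb⟩ := hC
      obtain ⟨c₁, h1, h1', h1'', -⟩ := exists_concentrate c hl ha
      obtain ⟨c₂, h2, h2', -, h2''⟩ := exists_concentrate c hl hb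
      refine ⟨_, _, fun he => ?_, ⟨h1, h1'⟩, ⟨h2, h2'⟩⟩
      have := h2'' a hab hap
      rw [← branch_injective he] at this
      exact absurd (this.trans_le h1'') (lt_irrefl _)
    push Not at hC
    by_cases hA : ∃ a, ¬ (c a).NewtonDimLE (c a).vars.card
    · obtain ⟨a, ha⟩ := hA
      obtain ⟨s₁, s₂, hne, ⟨hs₁, hd₁⟩, ⟨hs₂, hd₂⟩⟩ := ih a ha
      suffices h : ∃ c' : ∀ p : Pos r.output, DTree G p.var,
          ∀ s : DTree G (a : Pos r.output).var, s.rules = (c a).rules →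
          s.NewtonDimLE (c a).vars.card →
          (branch r hr (Function.update c' a s)).rules = (branch r hr c).rules ∧
          (branch r hr (Function.update c' a s)).NewtonDimLE (l + 1) by
        obtain ⟨c', hc'⟩ := h
        refine ⟨_, _, fun he => hne ?_, hc' s₁ hs₁ hd₁, hc' s₂ hs₂ hd₂⟩
        have := congrFun (branch_injective he) a
        rwa [Function.update_self, Function.update_self] at this
      by_cases hfull : (c a).vars = (branch r hr c).vars
      · have hap : (c a).Pumpable := by
          by_contra hap
          exact ha (newtonDimLE_of_not_pumpable hap (Nat.le_succ _))
        choose c' hc' hd' using fun p => exists_newtonDimLE (c p)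
        refine ⟨c', fun s hs hd => ⟨rules_branch_congr fun p => ?_, ?_⟩⟩
        · by_cases hp : p = a
          · subst hp
            rw [Function.update_self, hs]
          · rw [Function.update_of_ne hp, hc']
        · rw [newtonDimLE_branch_succ]
          refine .inr ⟨a, ?_, fun p hp => ?_⟩
          · rw [Function.update_self]
            exact hd.mono ((Finset.card_le_card (hsub a)).trans hl.le)
          · rw [Function.update_of_ne hp]
            exact (hd' p).mono (card_vars_le_of_ne hl.le (hsub p)
              (hC a p (Ne.symm hp) ⟨hfull, hap⟩))
      · have hal := card_vars_le_of_ne hl.le (hsub a) hfull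
        obtain ⟨c', h1, h2, g, h3, h4⟩ := exists_rearrange_on c (Finset.univ.erase a) a hl.le
          input_mem_vars_branch fun Y s _ => exists_newtonDimLE s
        refine ⟨c', fun s hs hd => ⟨?_, ?_⟩⟩
        · have := sum_rules_update c' a s
          rw [hs, h2 a (Finset.notMem_erase _ _)] at this
          rw [rules_branch, rules_branch, add_right_cancel this, h1]
        · rw [newtonDimLE_branch_succ]
          have hmem : ∀ p, p ≠ a → p ∈ Finset.univ.erase a := fun p hp =>
            Finset.mem_erase.2 ⟨hp, Finset.mem_univ _⟩
          refine .inr ⟨g, ?_, fun p hp => ?_⟩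
          · by_cases hga : g = a
            · subst hga
              rw [Function.update_self]
              exact hd.mono (hal.trans l.le_succ)
            · rw [Function.update_of_ne hga]
              exact h3 (hmem g hga)
          · by_cases hpa : p = a
            · subst hpa
              rw [Function.update_self]
              exact hd.mono hal
            · rw [Function.update_of_ne hpa]
              exact h4 p (hmem p hpa) hp
    · push Not at hA
      exfalso
      have hfull : ∀ p, ¬ (c p).NewtonDimLE l →
          (c p).vars = (branch r hr c).vars ∧ (c p).Pumpable := fun p hp => by
        refine ⟨?_, ?_⟩
        · by_contra hne
          exact hp ((hA p).mono (card_vars_le_of_ne hl.le (hsub p) hne))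
        · by_contra hpp
          exact hp (newtonDimLE_of_not_pumpable hpp ((Finset.card_le_card (hsub p)).trans hl.le))
      have hA' : ∀ p, (c p).NewtonDimLE (l + 1) := fun p =>
        (hA p).mono ((Finset.card_le_card (hsub p)).trans hl.le)
      rw [newtonDimLE_branch_succ, not_or] at ht
      obtain ⟨he, ht⟩ := ht
      push Not at ht
      obtain ⟨p₀⟩ := not_isEmpty_iff.1 he
      obtain ⟨a, -, ha⟩ := ht p₀ (hA' p₀)
      obtain ⟨b, hba, hb⟩ := ht a (hA' a)
      exact hC a b hba.symm (hfull a ha) (hfull b hb).1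

/-- A tree whose Newton dimension exceeds the number of its variables by more than `m` has many
rearrangements of smaller Newton dimension. -/
theorem exists_many_newtonDimLE (m : ℕ) {X : V} (t : DTree G X)
    (ht : ¬ t.NewtonDimLE (t.vars.card + m)) :
    ∃ F : Finset (DTree G X), F.card = 2 ^ 2 ^ m ∧
      ∀ s ∈ F, s.rules = t.rules ∧ s.NewtonDimLE (t.vars.card + m) := by
  classical
  induction m generalizing X t with
  | zero =>
    obtain ⟨t₁, t₂, hne, h1, h2⟩ := exists_two_newtonDimLE t ht
    refine ⟨{t₁, t₂}, by rw [Finset.card_pair hne]; rfl, fun s hs => ?_⟩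
    obtain rfl | hs := Finset.mem_insert.1 hs
    · exact h1
    · exact Finset.mem_singleton.1 hs ▸ h2
  | succ m ihm =>
    induction t using branch_induction with
    | branch r hr c ih =>
      have hsub : ∀ p, (c p).vars.card ≤ (branch r hr c).vars.card := fun p =>
        Finset.card_le_card (vars_mono (rules_lt_branch p).le)
      set n := (branch r hr c).vars.card
      choose c' hc' hd' using fun p => exists_newtonDimLE (c p)
      by_cases hA : ∃ a, ¬ (c a).NewtonDimLE ((c a).vars.card + (m + 1))
      · obtain ⟨a, ha⟩ := hA
        obtain ⟨F, hF, hFs⟩ := ih a ha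
        refine ⟨F.image fun s => branch r hr (Function.update c' a s), ?_, fun s hs => ?_⟩
        · rw [Finset.card_image_of_injective _ fun s s' he =>
            Function.update_injective c' a (branch_injective he), hF]
        · obtain ⟨s, hsF, rfl⟩ := Finset.mem_image.1 hs
          rw [← add_assoc, newtonDimLE_branch_succ]
          refine ⟨rules_branch_congr fun p => ?_, .inr ⟨a, ?_, fun p hp => ?_⟩⟩
          · by_cases hp : p = a
            · subst hp
              rw [Function.update_self, (hFs s hsF).1]
            · rw [Function.update_of_ne hp, hc']
          · rw [Function.update_self]
            exact (hFs s hsF).2.mono (by have := hsub a; omega)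
          · rw [Function.update_of_ne hp]
            exact (hd' p).mono (by have := hsub p; omega)
      · push Not at hA
        have hA' : ∀ p, (c p).NewtonDimLE (n + m + 1) := fun p =>
          (hA p).mono (by have := hsub p; omega)
        rw [← add_assoc, newtonDimLE_branch_succ, not_or] at ht
        obtain ⟨he, ht⟩ := ht
        push Not at ht
        obtain ⟨p₀⟩ := not_isEmpty_iff.1 he
        obtain ⟨a, -, ha⟩ := ht p₀ (hA' p₀)
        obtain ⟨b, hba, hb⟩ := ht a (hA' a)
        have hm : ∀ p, ¬ (c p).NewtonDimLE (n + m) → ∃ F : Finset (DTree G p.var),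
            F.card = 2 ^ 2 ^ m ∧ ∀ s ∈ F, s.rules = (c p).rules ∧ s.NewtonDimLE (n + m) :=
          fun p hp =>
            let ⟨F, hF, hFs⟩ := ihm (c p) fun h => hp (h.mono (by have := hsub p; omega))
            ⟨F, hF, fun s hs => ⟨(hFs s hs).1, (hFs s hs).2.mono (by have := hsub p; omega)⟩⟩
        obtain ⟨F₁, hF₁, hFs₁⟩ := hm a ha
        obtain ⟨F₂, hF₂, hFs₂⟩ := hm b hb
        refine ⟨(F₁ ×ˢ F₂).image fun s =>
          branch r hr (Function.update (Function.update c' a s.1) b s.2), ?_, fun s hs => ?_⟩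
        · rw [Finset.card_image_of_injective, Finset.card_product, hF₁, hF₂, ← pow_add, pow_succ,
            mul_two]
          rintro ⟨s₁, s₂⟩ ⟨s₁', s₂'⟩ he
          have h1 := congrFun (branch_injective he) a
          have h2 := congrFun (branch_injective he) b
          simp only [Function.update_self, Function.update_of_ne hba.symm] at h1 h2
          rw [h1, h2]
        · obtain ⟨⟨s₁, s₂⟩, hsF, rfl⟩ := Finset.mem_image.1 hs
          obtain ⟨hs₁, hs₂⟩ := Finset.mem_product.1 hsF
          dsimp only
          have key : ∀ p, (Function.update (Function.update c' a s₁) b s₂ p).rules =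
              (c p).rules ∧ (Function.update (Function.update c' a s₁) b s₂ p).NewtonDimLE
              (n + m) := fun p => by
            by_cases hpb : p = b
            · subst hpb
              rw [Function.update_self]
              exact hFs₂ s₂ hs₂
            rw [Function.update_of_ne hpb]
            by_cases hpa : p = a
            · subst hpa
              rw [Function.update_self]
              exact hFs₁ s₁ hs₁
            rw [Function.update_of_ne hpa]
            exact ⟨hc' p, (hd' p).mono (by have := hsub p; omega)⟩
          exact ⟨rules_branch_congr fun p => (key p).1, newtonDimLE_branch_succ.2
            (.inr ⟨a, (key a).2.mono (Nat.le_succ _), fun p _ => (key p).2⟩)⟩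

variable [DecidableEq A] [Fintype V]

/-- Up to the multiplicity `2 ^ 2 ^ m`, the trees of Newton dimension at most `|V| + m` realize
the commutative ambiguity. -/
theorem min_camb_le_encard (m : ℕ) (X : V) (v : A → ℕ) :
    min (camb G X v) (2 ^ 2 ^ m : ℕ) ≤
      {t : DTree G X | t.NewtonDimLE (Fintype.card V + m) ∧ parikh t.yield = v}.encard := by
  by_cases h : ∀ t : DTree G X, parikh t.yield = v → t.NewtonDimLE (Fintype.card V + m)
  · refine (min_le_left _ _).trans (Set.encard_le_encard fun t ht => ⟨h t ht, ht⟩)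
  · push Not at h
    obtain ⟨t, rfl, ht⟩ := h
    have hle : t.vars.card + m ≤ Fintype.card V + m :=
      Nat.add_le_add_right (Finset.card_le_univ _) m
    obtain ⟨F, hF, hFs⟩ := exists_many_newtonDimLE m t fun h => ht (h.mono hle)
    refine (min_le_right _ _).trans ?_
    rw [← hF, ← Set.encard_coe_eq_coe_finsetCard]
    exact Set.encard_le_encard fun s hs =>
      ⟨(hFs s hs).2.mono hle, parikh_yield_congr (hFs s hs).1⟩

end Rearrange

end DTree

/-! ### Positions of variables and relabelling -/

section Relabel

variable {A V W β : Type*}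

theorem Pos.getElem?_eq {γ : List (Symbol A V)} (p : Pos γ) :
    γ[(p.idx : ℕ)]? = some (Symbol.nonterminal p.var) := by
  rw [List.getElem?_eq_getElem p.idx.2]
  exact congrArg some p.eq

theorem Pos.exists_of_getElem?_eq {γ : List (Symbol A V)} {i : ℕ} {Y : V}
    (h : γ[i]? = some (Symbol.nonterminal Y)) : ∃ p : Pos γ, (p.idx : ℕ) = i ∧ p.var = Y := by
  obtain ⟨hi, he⟩ := List.getElem?_eq_some_iff.1 h
  exact ⟨⟨⟨i, hi⟩, Y, he⟩, rfl, rfl⟩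

theorem mem_varPos_iff {γ : List (Symbol A V)} {i : ℕ} :
    i ∈ varPos γ ↔ ∃ Y, γ[i]? = some (Symbol.nonterminal Y) := by
  simp only [varPos, Finset.mem_filter, Finset.mem_range]
  constructor
  · rintro ⟨hi, h⟩
    rw [List.getElem?_eq_getElem hi] at h ⊢
    cases hs : γ[i] with
    | terminal a => simp [hs, isVar] at h
    | nonterminal Y => exact ⟨Y, rfl⟩
  · rintro ⟨Y, h⟩
    exact ⟨(List.getElem?_eq_some_iff.1 h).1, by rw [h]; rfl⟩

theorem Pos.mem_varPos {γ : List (Symbol A V)} (p : Pos γ) : (p.idx : ℕ) ∈ varPos γ :=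
  mem_varPos_iff.2 ⟨_, p.getElem?_eq⟩

theorem exists_pos_of_mem_varPos {γ : List (Symbol A V)} {i : ℕ} (h : i ∈ varPos γ) :
    ∃ p : Pos γ, (p.idx : ℕ) = i :=
  let ⟨_, hY⟩ := mem_varPos_iff.1 h
  let ⟨p, hp, _⟩ := Pos.exists_of_getElem?_eq hY
  ⟨p, hp⟩

theorem sum_varPos {M : Type*} [AddCommMonoid M] (γ : List (Symbol A V)) (f : ℕ → M) :
    ∑ i ∈ varPos γ, f i = ∑ p : Pos γ, f p.idx := by
  refine (Finset.sum_bij (fun (p : Pos γ) _ => (p.idx : ℕ)) (fun p _ => p.mem_varPos)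
    (fun p _ q _ h => Pos.idx_injective (Fin.ext h)) (fun i hi => ?_) fun _ _ => rfl).symm
  obtain ⟨p, hp⟩ := exists_pos_of_mem_varPos hi
  exact ⟨p, Finset.mem_univ p, hp⟩

theorem getElem?_relabel {z : ℕ → V → W} {γ : List (Symbol A V)} {i : ℕ} {Z : W} :
    (relabel z γ)[i]? = some (Symbol.nonterminal Z) ↔
      ∃ Y, γ[i]? = some (Symbol.nonterminal Y) ∧ z i Y = Z := by
  rw [relabel, List.getElem?_mapIdx]
  cases γ[i]? with
  | none => simp
  | some s => cases s <;> simp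

theorem forall_pos_relabel {z : ℕ → V → W} {γ : List (Symbol A V)} {P : W → ℕ → Prop} :
    (∀ p : Pos (relabel z γ), P p.var p.idx) ↔ ∀ p : Pos γ, P (z p.idx p.var) p.idx := by
  constructor
  · intro h p
    obtain ⟨q, hq, hq'⟩ := Pos.exists_of_getElem?_eq
      (getElem?_relabel (z := z).2 ⟨_, p.getElem?_eq, rfl⟩)
    rw [← hq', ← hq]
    exact h q
  · intro h p
    obtain ⟨Y, hY, he⟩ := getElem?_relabel.1 p.getElem?_eq
    obtain ⟨q, hq, rfl⟩ := Pos.exists_of_getElem?_eq hY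
    rw [← he, ← hq]
    exact h q

theorem relabel_congr {z z' : ℕ → V → W} {γ : List (Symbol A V)}
    (h : ∀ i ∈ varPos γ, ∀ Y, z i Y = z' i Y) : relabel z γ = relabel z' γ := by
  refine List.ext_getElem? fun i => ?_
  rw [relabel, relabel, List.getElem?_mapIdx, List.getElem?_mapIdx]
  cases hs : γ[i]? with
  | none => rfl
  | some s =>
    cases s with
    | terminal a => rfl
    | nonterminal Y => simp [h i (mem_varPos_iff.2 ⟨Y, hs⟩) Y]

/-- Rename the variable in a symbol. -/
def mapVar (f : W → V) : Symbol A W → Symbol A V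
  | .terminal a => .terminal a
  | .nonterminal Z => .nonterminal (f Z)

theorem getElem?_map_mapVar {f : W → V} {γ : List (Symbol A W)} {i : ℕ} {Y : V} :
    (γ.map (mapVar f))[i]? = some (Symbol.nonterminal Y) ↔
      ∃ Z, γ[i]? = some (Symbol.nonterminal Z) ∧ f Z = Y := by
  rw [List.getElem?_map]
  cases γ[i]? with
  | none => simp
  | some s => cases s <;> simp [mapVar]

theorem varPos_map_mapVar (f : W → V) (γ : List (Symbol A W)) :
    varPos (γ.map (mapVar f)) = varPos γ := by
  ext i
  simp only [mem_varPos_iff, getElem?_map_mapVar]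
  constructor
  · rintro ⟨_, Z, h, _⟩
    exact ⟨Z, h⟩
  · rintro ⟨Z, h⟩
    exact ⟨_, Z, h, rfl⟩

theorem letters_map_mapVar (f : W → V) (γ : List (Symbol A W)) :
    letters (γ.map (mapVar f)) = letters γ := by
  induction γ with
  | nil => rfl
  | cons s γ ih => cases s <;> simp [mapVar, letters, ih]

theorem map_mapVar_relabel {f : W → V} {z : ℕ → V → W} (hz : ∀ i Y, f (z i Y) = Y)
    (γ : List (Symbol A V)) : (relabel z γ).map (mapVar f) = γ := by
  refine List.ext_getElem? fun i => ?_
  rw [List.getElem?_map, relabel, List.getElem?_mapIdx]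
  cases γ[i]? with
  | none => rfl
  | some s => cases s <;> simp [mapVar, hz]

/-- Extend a function on the variable positions of `γ` by the value `b`. -/
def extend (γ : List (Symbol A V)) (b : β)
    (F : ∀ (i : Fin γ.length) (Y : V), γ[i] = Symbol.nonterminal Y → β) (i : ℕ) : β :=
  if hi : i < γ.length then
    match h : γ[(⟨i, hi⟩ : Fin γ.length)] with
    | .terminal _ => b
    | .nonterminal Y => F ⟨i, hi⟩ Y h
  else b

theorem extend_apply_pos {γ : List (Symbol A V)} {b : β}
    {F : ∀ (i : Fin γ.length) (Y : V), γ[i] = Symbol.nonterminal Y → β} (p : Pos γ) :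
    extend γ b F p.idx = F p.idx p.var p.eq := by
  rw [extend, dif_pos p.idx.2]
  split
  · next h =>
    have := p.eq.symm.trans h
    cases this
  · next Y h =>
    have := p.eq.symm.trans h
    cases this
    rfl

theorem extend_of_notMem {γ : List (Symbol A V)} {b : β}
    {F : ∀ (i : Fin γ.length) (Y : V), γ[i] = Symbol.nonterminal Y → β} {i : ℕ}
    (hi : i ∉ varPos γ) : extend γ b F i = b := by
  rw [extend]
  split_ifs with hl
  · split
    · rfl
    · next Y h =>
      exact absurd (mem_varPos_iff.2 ⟨Y, List.getElem?_eq_some_iff.2 ⟨hl, h⟩⟩) hi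
  · rfl

theorem extend_eq {γ : List (Symbol A V)} {b : β}
    {F : ∀ (i : Fin γ.length) (Y : V), γ[i] = Symbol.nonterminal Y → β} {k : ℕ → β}
    (h1 : ∀ p : Pos γ, F p.idx p.var p.eq = k p.idx) (h2 : ∀ i ∉ varPos γ, k i = b) :
    extend γ b F = k := by
  funext i
  by_cases hi : i ∈ varPos γ
  · obtain ⟨p, rfl⟩ := exists_pos_of_mem_varPos hi
    rw [extend_apply_pos, h1]
  · rw [extend_of_notMem hi, h2 i hi]

end Relabel

/-! ### The dimension of a derivation tree and its annotation -/

section Dimension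

variable {A V : Type*}

/-- The maximal dimension of a child. -/
def maxDim (γ : List (Symbol A V)) (δ : ℕ → ℕ) : ℕ := (varPos γ).sup δ

/-- The positions of the children of maximal dimension. -/
def argMaxDim (γ : List (Symbol A V)) (δ : ℕ → ℕ) : Finset ℕ :=
  (varPos γ).filter fun i => δ i = maxDim γ δ

/-- The dimension of a tree in terms of the dimensions `δ` of its children. -/
def nodeDim (γ : List (Symbol A V)) (δ : ℕ → ℕ) : ℕ :=
  if 2 ≤ (argMaxDim γ δ).card then maxDim γ δ + 1 else maxDim γ δ

theorem maxDim_le_nodeDim (γ : List (Symbol A V)) (δ : ℕ → ℕ) : maxDim γ δ ≤ nodeDim γ δ := by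
  rw [nodeDim]
  split_ifs <;> omega

theorem Pos.le_maxDim {γ : List (Symbol A V)} (δ : ℕ → ℕ) (p : Pos γ) :
    δ p.idx ≤ maxDim γ δ := Finset.le_sup p.mem_varPos

theorem argMaxDim_nonempty {γ : List (Symbol A V)} {δ : ℕ → ℕ} (h : (varPos γ).Nonempty) :
    (argMaxDim γ δ).Nonempty := by
  obtain ⟨i, hi, he⟩ := Finset.exists_mem_eq_sup _ h δ
  exact ⟨i, Finset.mem_filter.2 ⟨hi, he.symm⟩⟩

theorem maxDim_argMaxDim_eq {γ : List (Symbol A V)} {δ : ℕ → ℕ} {J : Finset ℕ} {e : ℕ}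
    (hJ : J ⊆ varPos γ) (hne : J.Nonempty) (h1 : ∀ i ∈ J, δ i = e)
    (h2 : ∀ i ∈ varPos γ, i ∉ J → δ i < e) : maxDim γ δ = e ∧ argMaxDim γ δ = J := by
  have h : maxDim γ δ = e := by
    refine le_antisymm (Finset.sup_le fun i hi => ?_) ?_
    · by_cases hiJ : i ∈ J
      · exact (h1 i hiJ).le
      · exact (h2 i hi hiJ).le
    · obtain ⟨i, hi⟩ := hne
      exact (h1 i hi).symm.trans_le (Finset.le_sup (hJ hi))
  refine ⟨h, Finset.ext fun i => ?_⟩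
  rw [argMaxDim, Finset.mem_filter, h]
  refine ⟨fun ⟨hi, he⟩ => ?_, fun hi => ⟨hJ hi, h1 i hi⟩⟩
  by_contra hiJ
  exact (h2 i hi hiJ).ne he

/-- Erase the superscript of a variable of the unfolding. -/
def UVar.base : UVar V → V
  | .atMost X _ => X
  | .exactly X _ => X

/-- The dimensions of the trees that a variable of the unfolding stands for. -/
def UVar.Fits : UVar V → ℕ → Prop
  | .atMost _ e, n => n ≤ e
  | .exactly _ e, n => n = e

/-- The superscript of a variable of the unfolding. -/
def UVar.level : UVar V → ℕ
  | .atMost _ e => e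
  | .exactly _ e => e

/-- The variable with which the unfolding annotates the child at position `i`. -/
def annotation (γ : List (Symbol A V)) (δ : ℕ → ℕ) (i : ℕ) (Y : V) : UVar V :=
  if i ∈ argMaxDim γ δ then .exactly Y (maxDim γ δ) else .atMost Y (maxDim γ δ - 1)

/-- The rule of the unfolding that fits a rule `r` and children of dimensions `δ`. -/
def annotatedRule (r : ContextFreeRule A V) (δ : ℕ → ℕ) : ContextFreeRule A (UVar V) :=
  ⟨.exactly r.input (nodeDim r.output δ), relabel (annotation r.output δ) r.output⟩

theorem annotatedRule_fits {r : ContextFreeRule A V} {δ : ℕ → ℕ}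
    (p : Pos (annotatedRule r δ).output) : p.var.Fits (δ p.idx) := by
  revert p
  refine (forall_pos_relabel (P := fun (Z : UVar V) i => Z.Fits (δ i))).2 fun p => ?_
  rw [annotation]
  split_ifs with h
  · exact (Finset.mem_filter.1 h).2
  · have h1 := p.le_maxDim δ
    have h2 : δ p.idx ≠ maxDim r.output δ := fun h2 =>
      h (Finset.mem_filter.2 ⟨p.mem_varPos, h2⟩)
    show δ p.idx ≤ _
    omega

theorem annotatedRule_level_le {r : ContextFreeRule A V} {δ : ℕ → ℕ}
    (p : Pos (annotatedRule r δ).output) : p.var.level ≤ nodeDim r.output δ := by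
  revert p
  refine (forall_pos_relabel (P := fun (Z : UVar V) _ => Z.level ≤ nodeDim r.output δ)).2 fun p => ?_
  have := maxDim_le_nodeDim r.output δ
  rw [annotation]
  split_ifs
  · exact this
  · exact (Nat.sub_le _ _).trans this

variable [DecidableEq A] [DecidableEq V]

theorem exists_of_mem_unfoldRule {d : ℕ} {r : ContextFreeRule A V}
    {r' : ContextFreeRule A (UVar V)} (h : r' ∈ unfoldRule d r) :
    ∃ (e : ℕ) (z : ℕ → V → UVar V), r' = ⟨.exactly r.input e, relabel z r.output⟩ ∧
      ∀ i Y, (z i Y).base = Y := by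
  rw [unfoldRule] at h
  split_ifs at h
  · exact ⟨_, _, Finset.mem_singleton.1 h, fun _ _ => rfl⟩
  · obtain ⟨e, -, rfl⟩ := Finset.mem_image.1 h
    exact ⟨_, _, rfl, fun _ _ => rfl⟩
  · obtain ⟨e, -, h⟩ := Finset.mem_biUnion.1 h
    obtain h | h := Finset.mem_union.1 h
    · obtain ⟨j, -, rfl⟩ := Finset.mem_image.1 h
      exact ⟨_, _, rfl, fun _ _ => by split_ifs <;> rfl⟩
    · obtain ⟨J, -, rfl⟩ := Finset.mem_image.1 h
      exact ⟨_, _, rfl, fun _ _ => by split_ifs <;> rfl⟩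

/-- The only rule of the unfolding that fits `r` and children of dimensions `δ` is
`annotatedRule r δ`. -/
theorem eq_annotatedRule {d : ℕ} {r : ContextFreeRule A V} {δ : ℕ → ℕ}
    {r' : ContextFreeRule A (UVar V)} (h : r' ∈ unfoldRule d r)
    (hfit : ∀ p : Pos r'.output, p.var.Fits (δ p.idx)) : r' = annotatedRule r δ := by
  have hz : ∀ {e : ℕ} {z : ℕ → V → UVar V}, r' = ⟨.exactly r.input e, relabel z r.output⟩ →
      ∀ i ∈ varPos r.output, ∃ Y, (z i Y).Fits (δ i) := by
    rintro e z rfl i hi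
    obtain ⟨p, rfl⟩ := exists_pos_of_mem_varPos hi
    exact ⟨_, (forall_pos_relabel (P := fun (Z : UVar V) i => Z.Fits (δ i))).1 hfit p⟩
  have key : ∀ {e : ℕ} {z : ℕ → V → UVar V}, r' = ⟨.exactly r.input e, relabel z r.output⟩ →
      e = nodeDim r.output δ → (∀ i ∈ varPos r.output, ∀ Y, z i Y = annotation r.output δ i Y) →
      r' = annotatedRule r δ := by
    rintro e z rfl rfl h
    rw [annotatedRule, relabel_congr h]
  rw [unfoldRule] at h
  split_ifs at h with h0 h1
  · have he := Finset.mem_singleton.1 h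
    rw [Finset.card_eq_zero] at h0
    refine key he ?_ (by simp [h0])
    simp [nodeDim, maxDim, argMaxDim, h0]
  · obtain ⟨e, -, he⟩ := Finset.mem_image.1 h
    have hf := hz he.symm
    have h1' := h1
    obtain ⟨j, hj⟩ := Finset.card_eq_one.1 h1
    obtain ⟨hm, ha⟩ := maxDim_argMaxDim_eq (γ := r.output) (δ := δ) (J := varPos r.output) (e := e)
      subset_rfl (by simp [hj]) (fun i hi => (hf i hi).elim fun _ h => h)
      fun i hi hi' => absurd hi hi'
    refine key he.symm ?_ fun i hi Y => ?_
    · rw [nodeDim, ha, hm, if_neg (by omega)]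
    · rw [annotation, ha, hm, if_pos hi]
  · obtain ⟨e, he, h⟩ := Finset.mem_biUnion.1 h
    rw [Finset.mem_Icc] at he
    obtain h | h := Finset.mem_union.1 h
    · obtain ⟨j, hj, hr⟩ := Finset.mem_image.1 h
      have hf := hz hr.symm
      obtain ⟨hm, ha⟩ := maxDim_argMaxDim_eq (γ := r.output) (δ := δ) (J := {j}) (e := e)
        (by simpa using hj) (by simp) (fun i hi => by
          obtain rfl := Finset.mem_singleton.1 hi
          obtain ⟨Y, hY⟩ := hf i hj
          rw [if_pos rfl] at hY
          exact hY) fun i hi hi' => by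
          obtain ⟨Y, hY⟩ := hf i hi
          rw [if_neg (by simpa using hi')] at hY
          have : δ i ≤ e - 1 := hY
          omega
      refine key hr.symm ?_ fun i hi Y => ?_
      · rw [nodeDim, ha, hm, if_neg (by simp)]
      · simp only [annotation, ha, hm, Finset.mem_singleton]
    · obtain ⟨J, hJ, hr⟩ := Finset.mem_image.1 h
      rw [Finset.mem_filter, Finset.mem_powerset] at hJ
      obtain ⟨hJs, hJc, hJe⟩ := hJ
      have hf := hz hr.symm
      obtain ⟨hm, ha⟩ := maxDim_argMaxDim_eq (γ := r.output) (δ := δ) (J := J) (e := e - 1)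
        hJs (Finset.card_pos.1 (by omega)) (fun i hi => by
          obtain ⟨Y, hY⟩ := hf i (hJs hi)
          rw [if_pos hi] at hY
          exact hY) fun i hi hi' => by
          obtain ⟨Y, hY⟩ := hf i hi
          rw [if_neg hi'] at hY
          have : δ i ≤ e - 2 := hY
          have : J ≠ varPos r.output := fun h => hi' (h ▸ hi)
          have := hJe.resolve_right this
          omega
      refine key hr.symm ?_ fun i hi Y => ?_
      · rw [nodeDim, ha, hm, if_pos hJc]
        omega
      · simp only [annotation, ha, hm]
        rfl

theorem annotatedRule_mem {d : ℕ} {r : ContextFreeRule A V} {δ : ℕ → ℕ}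
    (hd : nodeDim r.output δ ≤ d) : annotatedRule r δ ∈ unfoldRule d r := by
  have key : ∀ {e : ℕ} {z : ℕ → V → UVar V}, e = nodeDim r.output δ →
      (∀ i ∈ varPos r.output, ∀ Y, z i Y = annotation r.output δ i Y) →
      (⟨.exactly r.input e, relabel z r.output⟩ : ContextFreeRule A (UVar V)) =
        annotatedRule r δ := by
    rintro e z rfl h
    rw [annotatedRule, relabel_congr h]
  have hsub : argMaxDim r.output δ ⊆ varPos r.output := Finset.filter_subset _ _
  have hpos : argMaxDim r.output δ ≠ varPos r.output → 1 ≤ maxDim r.output δ := by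
    intro hne
    obtain ⟨i, hi, hi'⟩ := Finset.exists_of_ssubset (hsub.ssubset_of_ne hne)
    have h1 : δ i ≤ maxDim r.output δ := Finset.le_sup hi
    have h2 : δ i ≠ maxDim r.output δ := fun h => hi' (Finset.mem_filter.2 ⟨hi, h⟩)
    omega
  rw [unfoldRule]
  split_ifs with h0 h1
  · rw [Finset.card_eq_zero] at h0
    refine Finset.mem_singleton.2 (key ?_ (by simp [h0])).symm
    simp [nodeDim, maxDim, argMaxDim, h0]
  · have ha : argMaxDim r.output δ = varPos r.output :=
      Finset.eq_of_subset_of_card_le hsub (h1.trans_le (Finset.card_pos.2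
        (argMaxDim_nonempty (Finset.card_pos.1 (by omega)))))
    refine Finset.mem_image.2 ⟨nodeDim r.output δ, Finset.mem_range.2 (by omega),
      key rfl fun i hi Y => ?_⟩
    rw [annotation, ha, if_pos hi, nodeDim, ha, if_neg (by omega)]
  · have hne : (argMaxDim r.output δ).Nonempty :=
      argMaxDim_nonempty (Finset.card_pos.1 (by omega))
    have hc := Finset.card_pos.2 hne
    refine Finset.mem_biUnion.2 ⟨nodeDim r.output δ, ?_, Finset.mem_union.2 ?_⟩
    · refine Finset.mem_Icc.2 ⟨?_, hd⟩
      rw [nodeDim]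
      split_ifs with h2
      · omega
      · exact hpos fun h => by rw [h] at h2; omega
    · by_cases h2 : 2 ≤ (argMaxDim r.output δ).card
      · have hn : nodeDim r.output δ = maxDim r.output δ + 1 := if_pos h2
        refine .inr (Finset.mem_image.2 ⟨argMaxDim r.output δ, Finset.mem_filter.2
          ⟨Finset.mem_powerset.2 hsub, h2, ?_⟩, key rfl fun i _ Y => ?_⟩)
        · by_cases he : argMaxDim r.output δ = varPos r.output
          · exact .inr he
          · have := hpos he
            exact .inl (by omega)
        · rw [hn]
          rfl
      · have hn : nodeDim r.output δ = maxDim r.output δ := if_neg h2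
        obtain ⟨j, hj⟩ := Finset.card_eq_one.1 (by omega : (argMaxDim r.output δ).card = 1)
        refine .inl (Finset.mem_image.2 ⟨j, hsub (by simp [hj]), key rfl fun i _ Y => ?_⟩)
        simp only [annotation, hj, hn, Finset.mem_singleton]

end Dimension

/-! ### Derivation trees of the unfolding -/

section Skeleton

variable {A V : Type*}

/-- Trees with nodes labelled in `R` and children indexed by `ℕ`. -/
inductive RTree (R : Type*) where
  | leaf : RTree R
  | node (r : R) (child : ℕ → RTree R) : RTree R

/-- The dimension of a tree. -/
def RTree.dim : RTree (ContextFreeRule A V) → ℕ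
  | .leaf => 0
  | .node r child => nodeDim r.output fun i => (child i).dim

/-- The multiset of letters in the yield of a tree. -/
def RTree.letters : RTree (ContextFreeRule A V) → Multiset A
  | .leaf => 0
  | .node r child => CamNewton.letters r.output + ∑ i ∈ varPos r.output, (child i).letters

/-- Forget the types in a derivation tree. -/
def DTree.skeleton {G : Grammar A V} {X : V} : DTree G X → RTree (ContextFreeRule A V)
  | .node r _ _ child => .node r (extend r.output .leaf fun i Y h => (child i Y h).skeleton)

/-- Erase the superscripts of the variables in a rule. -/
def eraseRule (r : ContextFreeRule A (UVar V)) : ContextFreeRule A V :=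
  ⟨r.input.base, r.output.map (mapVar UVar.base)⟩

/-- Contract the chain rules and erase the superscripts in a derivation tree of an unfolding. -/
def DTree.erase {G : Grammar A (UVar V)} {Z : UVar V} : DTree G Z → RTree (ContextFreeRule A V)
  | .node r _ _ child =>
    match r.input with
    | .atMost _ _ => extend r.output .leaf (fun i Y h => (child i Y h).erase) 0
    | .exactly _ _ => .node (eraseRule r)
        (extend r.output .leaf fun i Y h => (child i Y h).erase)

namespace DTree

section

variable {G : Grammar A V}

/-- The skeletons of the children of a node. -/
def childSkeleton {r : ContextFreeRule A V} (c : ∀ p : Pos r.output, DTree G p.var) :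
    ℕ → RTree (ContextFreeRule A V) :=
  extend r.output .leaf fun i Y h => (c ⟨i, Y, h⟩).skeleton

theorem childSkeleton_apply {r : ContextFreeRule A V} (c : ∀ p : Pos r.output, DTree G p.var)
    (p : Pos r.output) : childSkeleton c p.idx = (c p).skeleton := extend_apply_pos p

theorem skeleton_branch {r : ContextFreeRule A V} {hr : r ∈ G.rules}
    {c : ∀ p : Pos r.output, DTree G p.var} :
    (branch r hr c).skeleton = .node r (childSkeleton c) := by
  rw [branch, skeleton]
  rfl

theorem skeleton_injective {X : V} :
    Function.Injective (skeleton : DTree G X → RTree (ContextFreeRule A V)) := by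
  intro t
  induction t using branch_induction with
  | branch r hr c ih =>
    intro t' h
    cases t' with
    | node r' hr' hX child =>
      have h' := h
      rw [skeleton_branch, skeleton, RTree.node.injEq] at h'
      obtain ⟨rfl, hk⟩ := h'
      have hc : c = fun p : Pos r.output => child p.idx p.var p.eq := funext fun p => ih p (by
        rw [← childSkeleton_apply, hk]
        exact extend_apply_pos p)
      exact congrArg (branch r hr) hc

theorem letters_skeleton {X : V} (t : DTree G X) :
    t.skeleton.letters = (t.yield : Multiset A) := by
  induction t using branch_induction with
  | branch r hr c ih =>
    rw [skeleton_branch, RTree.letters, yield_branch, sum_varPos]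
    simp only [childSkeleton_apply, ih]

theorem NewtonDimLE.dim_le {X : V} {t : DTree G X} {i : ℕ} (h : t.NewtonDimLE i) :
    t.skeleton.dim ≤ i := by
  revert i
  induction t using branch_induction with
  | branch r hr c ih =>
    intro i h
    rw [skeleton_branch, RTree.dim, nodeDim]
    set δ := fun i => (childSkeleton c i).dim
    obtain he | ⟨j, rfl, p, hp, hq⟩ := newtonDimLE_branch_iff.1 h
    · have h0 : varPos r.output = ∅ := Finset.eq_empty_of_forall_notMem fun i hi =>
        (exists_pos_of_mem_varPos hi).elim fun p _ => he.elim p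
      simp [maxDim, argMaxDim, h0]
    · have hδ : ∀ q, δ (q : Pos r.output).idx = (c q).skeleton.dim := fun q =>
        congrArg RTree.dim (childSkeleton_apply c q)
      have h1 : ∀ q, q ≠ p → δ (q : Pos r.output).idx ≤ j := fun q hqp =>
        (hδ q).trans_le (ih q (hq q hqp))
      have h2 : maxDim r.output δ ≤ j + 1 := Finset.sup_le fun i hi => by
        obtain ⟨q, rfl⟩ := exists_pos_of_mem_varPos hi
        by_cases hqp : q = p
        · subst hqp
          exact (hδ q).trans_le (ih q hp)
        · exact (h1 q hqp).trans j.le_succ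
      split_ifs with hc
      · by_contra hlt
        have hm : maxDim r.output δ = j + 1 := by omega
        have : argMaxDim r.output δ ⊆ {(p.idx : ℕ)} := fun i hi => by
          rw [argMaxDim, Finset.mem_filter, hm] at hi
          obtain ⟨q, rfl⟩ := exists_pos_of_mem_varPos hi.1
          by_cases hqp : q = p
          · rw [hqp, Finset.mem_singleton]
          · have := h1 q hqp
            omega
        have := Finset.card_le_card this
        rw [Finset.card_singleton] at this
        omega
      · exact h2

end

variable [DecidableEq A] [DecidableEq V] [Fintype V] {G : Grammar A V} {d : ℕ}

theorem mem_unfold_rules_iff {r : ContextFreeRule A (UVar V)} :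
    r ∈ (G.unfold d).rules ↔
      (∃ X n e, n ≤ d ∧ e ≤ n ∧ r = ⟨.atMost X n, [Symbol.nonterminal (.exactly X e)]⟩) ∨
      ∃ s ∈ G.rules, r ∈ unfoldRule d s := by
  simp only [Grammar.unfold, Finset.mem_union, Finset.mem_biUnion, Finset.mem_univ, true_and,
    Finset.mem_image, Finset.mem_range, Nat.lt_succ_iff]
  refine or_congr_left ?_
  constructor
  · rintro ⟨X, n, hn, e, he, rfl⟩
    exact ⟨X, n, e, hn, he, rfl⟩
  · rintro ⟨X, n, e, hn, he, rfl⟩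
    exact ⟨X, n, hn, e, he, rfl⟩

theorem eraseRule_of_mem_unfoldRule {s : ContextFreeRule A V} {r : ContextFreeRule A (UVar V)}
    (h : r ∈ unfoldRule d s) : eraseRule r = s ∧ ∃ e, r.input = .exactly s.input e := by
  obtain ⟨e, z, rfl, hz⟩ := exists_of_mem_unfoldRule h
  refine ⟨?_, e, rfl⟩
  rw [eraseRule, map_mapVar_relabel hz]
  rfl

/-- The erasures of the children of a node. -/
def childErase {G : Grammar A (UVar V)} {r : ContextFreeRule A (UVar V)}
    (c : ∀ p : Pos r.output, DTree G p.var) : ℕ → RTree (ContextFreeRule A V) :=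
  extend r.output .leaf fun i Y h => (c ⟨i, Y, h⟩).erase

theorem childErase_apply {G : Grammar A (UVar V)} {r : ContextFreeRule A (UVar V)}
    (c : ∀ p : Pos r.output, DTree G p.var) (p : Pos r.output) :
    childErase c p.idx = (c p).erase := extend_apply_pos p

theorem erase_branch_atMost {G : Grammar A (UVar V)} {X : V} {n : ℕ}
    {γ : List (Symbol A (UVar V))} {hr : ⟨.atMost X n, γ⟩ ∈ G.rules}
    {c : ∀ p : Pos γ, DTree G p.var} :
    (branch ⟨.atMost X n, γ⟩ hr c).erase = childErase (r := ⟨.atMost X n, γ⟩) c 0 := by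
  rw [branch, erase]
  rfl

theorem erase_branch_unfoldRule {s : ContextFreeRule A V} {r : ContextFreeRule A (UVar V)}
    (h : r ∈ unfoldRule d s) {G : Grammar A (UVar V)} {hr : r ∈ G.rules}
    {c : ∀ p : Pos r.output, DTree G p.var} :
    (branch r hr c).erase = .node s (childErase c) := by
  obtain ⟨he, e, hi⟩ := eraseRule_of_mem_unfoldRule h
  rw [branch, erase, hi, ← he]
  rfl

/-- The only variable position of a chain rule. -/
def chainPos {Z : UVar V} : Pos ([Symbol.nonterminal Z] : List (Symbol A (UVar V))) :=
  Pos.zero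

theorem erase_chain {G : Grammar A (UVar V)} {X : V} {n : ℕ} {Z : UVar V}
    {hr : ⟨.atMost X n, [Symbol.nonterminal Z]⟩ ∈ G.rules}
    {c : ∀ p : Pos [Symbol.nonterminal Z], DTree G p.var} :
    (branch ⟨.atMost X n, [Symbol.nonterminal Z]⟩ hr c).erase = (c chainPos).erase := by
  rw [erase_branch_atMost]
  exact childErase_apply (r := ⟨.atMost X n, [Symbol.nonterminal Z]⟩) c chainPos

theorem fits_dim_erase {Z : UVar V} (u : DTree (G.unfold d) Z) : Z.Fits u.erase.dim := by
  induction u using branch_induction with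
  | branch r hr c ih =>
    obtain ⟨X, n, e, hn, he, rfl⟩ | ⟨s, hs, h⟩ := mem_unfold_rules_iff.1 hr
    · rw [erase_chain]
      have h1 : (c chainPos).erase.dim = e := ih chainPos
      exact h1.trans_le he
    · rw [erase_branch_unfoldRule h, RTree.dim]
      have := eq_annotatedRule h (δ := fun i => (childErase c i).dim) fun p => by
        rw [childErase_apply]
        exact ih p
      rw [show r.input = _ from congrArg ContextFreeRule.input this]
      rfl

theorem erase_injective {Z : UVar V} :
    Function.Injective (erase : DTree (G.unfold d) Z → RTree (ContextFreeRule A V)) := by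
  intro u
  induction u using branch_induction with
  | branch r hr c ih =>
    intro u' h
    suffices H : ∀ (r' : ContextFreeRule A (UVar V)) (hr' : r' ∈ (G.unfold d).rules)
        (hX : r'.input = r.input) (c' : ∀ p : Pos r'.output, DTree (G.unfold d) p.var),
        (branch r hr c).erase = (branch r' hr' c').erase →
        r = r' ∧ ∀ (p : Pos r.output) (p' : Pos r'.output), (p.idx : ℕ) = p'.idx →
          (c p).erase = (c' p').erase by
      cases u' with
      | node r' hr' hX child =>
        have h' : (node r' hr' hX child).erase =
            (branch r' hr' fun p => child p.idx p.var p.eq).erase := by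
          rw [branch, erase, erase]
        obtain ⟨rfl, h2⟩ := H r' hr' hX (fun p => child p.idx p.var p.eq) (h.trans h')
        exact congrArg (branch r hr) (funext fun p => ih p (h2 p p rfl))
    intro r' hr' hX c' h
    obtain ⟨X, n, e, hn, he, rfl⟩ | ⟨s, hs, hu⟩ := mem_unfold_rules_iff.1 hr <;>
    obtain ⟨X', n', e', hn', he', rfl⟩ | ⟨s', hs', hu'⟩ := mem_unfold_rules_iff.1 hr'
    · obtain ⟨rfl, rfl⟩ := UVar.atMost.inj hX
      rw [erase_chain, erase_chain] at h
      have h1 : (c chainPos).erase.dim = e := fits_dim_erase (c chainPos)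
      have h2 : (c' chainPos).erase.dim = e' := fits_dim_erase (c' chainPos)
      have h3 : e = e' := by rw [← h1, ← h2, h]
      subst h3
      refine ⟨rfl, fun p p' _ => ?_⟩
      have hp : ∀ p : Pos ([Symbol.nonterminal (.exactly X' e)] : List (Symbol A (UVar V))),
          p = chainPos := fun p => Pos.idx_injective (Fin.ext (Nat.lt_one_iff.1 p.idx.2))
      rw [hp p, hp p', h]
    · obtain ⟨-, e, hi⟩ := eraseRule_of_mem_unfoldRule hu'
      rw [hi] at hX
      cases hX
    · obtain ⟨-, e, hi⟩ := eraseRule_of_mem_unfoldRule hu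
      rw [hi] at hX
      cases hX
    · rw [erase_branch_unfoldRule hu, erase_branch_unfoldRule hu', RTree.node.injEq] at h
      obtain ⟨rfl, hk⟩ := h
      have e1 := eq_annotatedRule hu (δ := fun i => (childErase c i).dim) fun p => by
        rw [childErase_apply]
        exact fits_dim_erase _
      have e2 := eq_annotatedRule hu' (δ := fun i => (childErase c' i).dim) fun p => by
        rw [childErase_apply]
        exact fits_dim_erase _
      refine ⟨e1.trans (hk ▸ e2.symm), fun p p' hpp => ?_⟩
      rw [← childErase_apply, ← childErase_apply, hk, hpp]

theorem letters_erase {Z : UVar V} (u : DTree (G.unfold d) Z) :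
    u.erase.letters = (u.yield : Multiset A) := by
  induction u using branch_induction with
  | branch r hr c ih =>
    obtain ⟨X, n, e, hn, he, rfl⟩ | ⟨s, hs, h⟩ := mem_unfold_rules_iff.1 hr
    · rw [erase_chain, ih, yield_branch, Pos.sum_cons_nonterminal]
      simp [letters, chainPos]
    · rw [erase_branch_unfoldRule h, RTree.letters, yield_branch]
      obtain ⟨rfl, -⟩ := eraseRule_of_mem_unfoldRule h
      simp only [eraseRule, letters_map_mapVar, varPos_map_mapVar, sum_varPos, childErase_apply,
        ih]

theorem exists_skeleton_eq_erase {Z : UVar V} (u : DTree (G.unfold d) Z) :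
    ∃ t : DTree G Z.base, t.skeleton = u.erase := by
  induction u using branch_induction with
  | branch r hr c ih =>
    obtain ⟨X, n, e, hn, he, rfl⟩ | ⟨s, hs, h⟩ := mem_unfold_rules_iff.1 hr
    · rw [erase_chain]
      exact ih chainPos
    · rw [erase_branch_unfoldRule h]
      obtain ⟨rfl, -⟩ := eraseRule_of_mem_unfoldRule h
      have hc : ∀ q : Pos (eraseRule r).output, ∃ t : DTree G q.var,
          t.skeleton = childErase c q.idx := fun q => by
        obtain ⟨Y, hY, hq⟩ := getElem?_map_mapVar.1 q.getElem?_eq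
        obtain ⟨p, hp, rfl⟩ := Pos.exists_of_getElem?_eq hY
        rw [← hq, ← hp, childErase_apply]
        exact ih p
      choose t ht using hc
      refine ⟨branch (eraseRule r) hs t, skeleton_branch.trans (congrArg (RTree.node (eraseRule r))
        (extend_eq ht fun i hi => extend_of_notMem ?_))⟩
      rwa [eraseRule, varPos_map_mapVar] at hi

theorem exists_erase_eq_of_fits {Y : V} {n : ℕ} (u : DTree (G.unfold d) (.exactly Y n))
    {Z : UVar V} (hb : Z.base = Y) (hf : Z.Fits n) (hl : Z.level ≤ d) :
    ∃ u' : DTree (G.unfold d) Z, u'.erase = u.erase := by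
  subst hb
  cases Z with
  | exactly X e =>
    obtain rfl : n = e := hf
    exact ⟨u, rfl⟩
  | atMost X e =>
    have hr : (⟨.atMost X e, [Symbol.nonterminal (.exactly X n)]⟩ :
        ContextFreeRule A (UVar V)) ∈ (G.unfold d).rules :=
      mem_unfold_rules_iff.2 (.inl ⟨X, e, n, hl, hf, rfl⟩)
    refine ⟨.node _ hr rfl fun i Z h => ?_, ?_⟩
    · have hi : i = ⟨0, Nat.one_pos⟩ := Fin.ext (Nat.lt_one_iff.1 i.2)
      subst hi
      exact Symbol.nonterminal.inj h ▸ u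
    · rw [erase]
      exact extend_apply_pos (chainPos (A := A) (Z := .exactly X n))

theorem exists_erase_eq_skeleton {X : V} (t : DTree G X) (hd : t.skeleton.dim ≤ d) :
    ∃ u : DTree (G.unfold d) (.exactly X t.skeleton.dim), u.erase = t.skeleton := by
  induction t using branch_induction with
  | branch r hr c ih =>
    simp only [skeleton_branch, RTree.dim] at hd ⊢
    set δ := fun i => (childSkeleton c i).dim with hδ
    have hmem := annotatedRule_mem hd
    have hc : ∀ p : Pos (annotatedRule r δ).output, ∃ u : DTree (G.unfold d) p.var,
        u.erase = childSkeleton c p.idx := fun p => by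
      have hf := annotatedRule_fits p
      have hl := (annotatedRule_level_le p).trans hd
      obtain ⟨Y, hY, hp⟩ := getElem?_relabel.1 p.getElem?_eq
      obtain ⟨q, hq, rfl⟩ := Pos.exists_of_getElem?_eq hY
      have hδq : δ p.idx = (c q).skeleton.dim := by
        rw [← hq]
        exact congrArg RTree.dim (childSkeleton_apply c q)
      rw [hδq] at hf
      obtain ⟨u, hu⟩ := ih q
        (hδq ▸ ((hq ▸ q.le_maxDim δ).trans (maxDim_le_nodeDim _ _)).trans hd)
      rw [← hq, childSkeleton_apply, ← hu]
      refine exists_erase_eq_of_fits u ?_ hf hl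
      rw [← hp, annotation]
      split_ifs <;> rfl
    choose u hu using hc
    refine ⟨branch (annotatedRule r δ) (mem_unfold_rules_iff.2 (.inr ⟨r, hr, hmem⟩)) u,
      (erase_branch_unfoldRule hmem).trans (congrArg (RTree.node r)
        (extend_eq hu fun i hi => extend_of_notMem ?_))⟩
    obtain ⟨he, -⟩ := eraseRule_of_mem_unfoldRule hmem
    rwa [← varPos_map_mapVar UVar.base, show (annotatedRule r δ).output.map (mapVar UVar.base) =
      r.output from congrArg ContextFreeRule.output he] at hi

theorem parikh_yield_eq_of_skeleton_eq {X : V} {Z : UVar V} {t : DTree G X}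
    {u : DTree (G.unfold d) Z} (h : t.skeleton = u.erase) :
    parikh t.yield = parikh u.yield := by
  have := congrArg RTree.letters h
  rw [letters_skeleton, letters_erase] at this
  funext a
  simp only [parikh, ← Multiset.coe_count, this]

/-- The unfolding is unambiguous. -/
theorem camb_unfold_le (X : V) (n : ℕ) (v : A → ℕ) :
    camb (G.unfold d) (.atMost X n) v ≤ camb G X v := by
  choose f hf using fun u : DTree (G.unfold d) (.atMost X n) => exists_skeleton_eq_erase u
  refine Set.encard_le_encard_of_injOn (f := f) (fun u hu => ?_) fun u _ u' _ h => ?_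
  · exact (parikh_yield_eq_of_skeleton_eq (hf u)).trans hu
  · refine erase_injective ?_
    rw [← hf, ← hf, h]

/-- The unfolding contains all trees of bounded dimension. -/
theorem le_camb_unfold (X : V) (v : A → ℕ) :
    {t : DTree G X | t.skeleton.dim ≤ d ∧ parikh t.yield = v}.encard ≤
      camb (G.unfold d) (.atMost X d) v := by
  have hex : ∀ t : DTree G X, ∃ u : Option (DTree (G.unfold d) (.atMost X d)),
      t.skeleton.dim ≤ d → ∃ u', u = some u' ∧ u'.erase = t.skeleton := fun t => by
    by_cases ht : t.skeleton.dim ≤ d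
    · obtain ⟨u, hu⟩ := exists_erase_eq_skeleton t ht
      obtain ⟨u', hu'⟩ := exists_erase_eq_of_fits u (Z := .atMost X d) rfl ht le_rfl
      exact ⟨some u', fun _ => ⟨u', rfl, hu'.trans hu⟩⟩
    · exact ⟨none, fun h => absurd h ht⟩
  choose f hf using hex
  rw [camb, ← (Option.some_injective (DTree (G.unfold d) (.atMost X d))).encard_image]
  refine Set.encard_le_encard_of_injOn (f := f) (fun t ht => ?_) fun t ht t' ht' h => ?_
  · obtain ⟨u, hu, he⟩ := hf t ht.1
    exact ⟨u, (parikh_yield_eq_of_skeleton_eq he.symm).symm.trans ht.2, hu.symm⟩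
  · obtain ⟨u, hu, he⟩ := hf t ht.1
    obtain ⟨u', hu', he'⟩ := hf t' ht'.1
    refine skeleton_injective ?_
    rw [← he, ← he', Option.some_injective _ (hu.symm.trans (h.trans hu'))]

end DTree

end Skeleton

section Main

variable {A V S : Type*} [Fintype A] [DecidableEq A] [Fintype V] [DecidableEq V] [CommSemiring S]
  [PartialOrder S] [CanonicallyOrderedAdd S] [OmegaContinuous S] (G : Grammar A V) (h : A → S)
  {k d : ℕ}

theorem min_camb_le (hd : d = Fintype.card V + logLog k) (X : V) (v : A → ℕ) :
    min (camb G X v) k ≤ {t : DTree G X | t.NewtonDimLE d ∧ parikh t.yield = v}.encard := by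
  subst hd
  refine le_trans (min_le_min_left _ ?_) (DTree.min_camb_le_encard (logLog k) X v)
  exact_mod_cast (logLog_le_iff k _).1 le_rfl

theorem evalSeries_camb_unfold (hS : (k : S) = (k : S) + 1)
    (hd : d = Fintype.card V + logLog k) (X : V) :
    evalSeries h (camb (G.unfold d) (UVar.atMost X d)) = evalSeries h (camb G X) := by
  rw [evalSeries, evalSeries]
  congr 1
  funext v
  rw [ofENat_congr hS (DTree.camb_unfold_le X d v)]
  refine ((min_camb_le G hd X v).trans (Set.encard_le_encard fun t ht => ?_)).trans
    (DTree.le_camb_unfold X v)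
  exact ⟨ht.1.dim_le, ht.2⟩

variable {G h}

theorem Grammar.IsNewtonSequence.isLeastSolution {ν : ℕ → V → S} (hν : G.IsNewtonSequence h ν)
    (hS : (k : S) = (k : S) + 1) (hd : d = Fintype.card V + logLog k) {i : ℕ} (hi : d ≤ i) :
    G.IsLeastSolution h (ν i) := by
  have hμ := isLeastSolution_evalSeries_camb (G := G) h hS
  have he : (fun X => evalSeries h (camb G X)) = ν i :=
    le_antisymm (fun X => (evalSeries_camb_le h hS (min_camb_le G hd X) fun _ hF =>
      DTree.sum_weight_le_newton h hν hF).trans (hν.monotone hi X)) (hν.le_leastSolution hμ i)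
  rwa [he] at hμ

end Main

end CamNewton

open CamNewton
theorem mainTheorem6 {A V S : Type*} [Fintype A] [DecidableEq A] [Fintype V] [DecidableEq V]
    [CommSemiring S] [PartialOrder S] [CanonicallyOrderedAdd S] [OmegaContinuous S]
    (G : Grammar A V) (h : A → S) (k : ℕ) (hk : 0 < k) (hS : (k : S) = (k : S) + 1)
    (d : ℕ) (hd : d = Fintype.card V + logLog k) :
    G.IsLeastSolution h (fun X => evalSeries h (camb (G.unfold d) (UVar.atMost X d))) ∧
    (∃ ν : ℕ → V → S, G.IsNewtonSequence h ν) ∧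
    (∀ ν : ℕ → V → S, G.IsNewtonSequence h ν → ∀ i, d ≤ i → G.IsLeastSolution h (ν i)) := by
  refine ⟨?_, G.exists_isNewtonSequence h, fun ν hν i hi => hν.isLeastSolution hS hd hi⟩
  simp only [evalSeries_camb_unfold G h hS hd]
  exact isLeastSolution_evalSeries_camb h hS
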